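/- **Setting.** Let $X$ be a connected (Hausdorff, second countable) smooth manifold without boundary; for example, a connected closed oriented manifold. Let $L=\{(\ell,\ell')\in\mathbb{C}^2:\ \mathrm{Im}(\ell'/\ell)>0\}$ be the manifold of oriented based lattices, and let $\pi TX$ be the odd tangent bundle, so that $C^\infty(L\times\pi TX)$ consists of the families of complex differential forms on $X$ that depend smoothly on $L$. Let $sL$ be the generalized supermanifold of based lattices $(\ell,\bar\ell,\sigma),(\ell',\bar\ell',\sigma')$ in the super group $\mathbb{R}^{2|1}$, with product $(z,\bar z,\theta)(w,\bar w,\eta)=(z+w,\bar z+\bar w+i\theta\eta,\theta+\eta)$. These satisfy $\sigma\sigma'=0$, and functions on $sL\times\pi TX$ are expressions $F_0+\sigma F_1+\sigma'F_2$ with $F_i\in C^\infty(L\times\pi TX)$. The group $\mathrm{SL}_2(\mathbb{Z})$ acts on $sL$ by change of basis, and $\mathbb{R}^{2|1}\rtimes\mathbb{C}^\times$ acts by conjugation and by the dilations $q\cdot(z,\bar z,\theta)=(q^2z,\bar q^2\bar z,\bar q\theta)$. Both act compatibly on maps $\mathbb{R}^{2|1}/\Lambda\to\mathbb{R}^{0|1}\to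 X$, i.e. on $sL\times\pi TX$, where the first map is $$\mathrm{proj}_\Lambda(z,\bar z,\theta)=\theta-\frac{(\sigma\ell'-\sigma'\ell)\bar z-(\sigma\bar\ell'-\sigma'\bar\ell)z}{\bar\ell\ell'-\bar\ell'\ell}.$$ Let $\Phi_\epsilon^{2|1}(X)$ be the stack of such pairs (a torus with a map to $X$), and let $\Phi_0^{2|1}(X)$, the stack of classical vacua, be its substack $\sigma=\sigma'=0$, presented by the action on $L\times\pi TX$. Functions on these stacks are the invariant functions on $sL\times\pi TX$, respectively on $L\times\pi TX$. Let $\widetilde\Phi_\epsilon^{2|1}(X)$ and $\widetilde\Phi_0^{2|1}(X)$ be the $\mathrm{SL}_2(\mathbb{Z})$-covers, for which only invariance under $\mathbb{R}^{2|1}\rtimes\mathbb{C}^\times$ is required. A function on $\Phi_0^{2|1}(X)$ (respectively $\widetilde\Phi_0^{2|1}(X)$) is *supersymmetric* if it is the restriction of a function on $\Phi_\epsilon^{2|1}(X)$ (respectively $\widetilde\Phi_\epsilon^{2|1}(X)$). Let $\mathcal{L}$ be a line bundle with hermitian metric on $\Phi_0^{2|1}(X)$ (respectively $\widetilde\Phi_0^{2|1}(X)$),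 with a preferred nonvanishing section $s_0$. A *supersymmetric trivialization* of $(\mathcal{L},s_0)$ is a section $f\cdot s_0$ of unit norm, with $f$ a supersymmetric function. **Lemma.** If a supersymmetric trivialization of $(\mathcal{L},s_0)$ exists, then it is unique up to a global phase: if $s$ and $t$ are supersymmetric trivializations, then $t=c\,s$ for a constant $c\in\mathbb{C}$ with $|c|=1$. Moreover, every real-valued supersymmetric function on $\Phi_0^{2|1}(X)$ or $\widetilde\Phi_0^{2|1}(X)$ (one equal to its complex conjugate in $C^\infty(L\times\pi TX)$) is a real constant. -/

import Mathlib

open scoped TensorProduct ContDiff Manifold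

noncomputable section

namespace ClassicalVacua

/-! ### Complex Grassmann algebras -/

/-- The complex Grassmann algebra `ℂ ⊗ Λ•(V)` of a real vector space `V`. -/
abbrev Gr (V : Type*) [AddCommGroup V] [Module ℝ V] : Type _ := ℂ ⊗[ℝ] ExteriorAlgebra ℝ V

section Grassmann

variable {V W : Type*} [AddCommGroup V] [Module ℝ V] [AddCommGroup W] [Module ℝ W]

instance [Module.Finite ℝ V] : Module.Finite ℝ (ExteriorAlgebra ℝ V) :=
  Module.Finite.of_basis (Module.finBasis ℝ V).ExteriorAlgebra

/-- The odd generator given by a vector. -/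
def Gr.gen (v : V) : Gr V := 1 ⊗ₜ[ℝ] ExteriorAlgebra.ι ℝ v

/-- Functoriality of the Grassmann algebra. -/
def Gr.map (f : V →ₗ[ℝ] W) : Gr V →ₐ[ℂ] Gr W :=
  Algebra.TensorProduct.map (AlgHom.id ℂ ℂ) (ExteriorAlgebra.map f)

/-- The parity involution: `+1` on even elements, `-1` on odd elements. -/
def Gr.parity : Gr V →ₐ[ℂ] Gr V := Gr.map (-LinearMap.id)

/-- Complex conjugation (the identity on the real exterior algebra). -/
def Gr.conj : Gr V →ₐ[ℝ] Gr V :=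
  Algebra.TensorProduct.map Complex.conjAe.toAlgHom (AlgHom.id ℝ _)

/-- The body: reduction modulo nilpotents. -/
def Gr.body : Gr V →ₐ[ℂ] ℂ :=
  Algebra.TensorProduct.lift (AlgHom.id ℂ ℂ)
    ((Algebra.ofId ℝ ℂ).comp ExteriorAlgebra.algebraMapInv) (fun _ _ => Commute.all _ _)

/-- The component of exterior degree `k`. -/
def Gr.comp (k : ℕ) : Gr V →ₗ[ℝ] Gr V :=
  TensorProduct.map LinearMap.id (GradedAlgebra.proj (fun i : ℕ => ⋀[ℝ]^i V) k)

/-- The directional derivative at `z`, in direction `v`, of a function with values in a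
finite-dimensional Grassmann algebra; it is taken coordinatewise. -/
def Gr.deriv [Module.Finite ℝ V] {F : Type*} [NormedAddCommGroup F] [NormedSpace ℝ F]
    (f : F → Gr V) (z v : F) : Gr V :=
  ∑ j, (fderiv ℝ (fun y => (Module.finBasis ℝ (Gr V)).repr (f y) j) z v) •
    Module.finBasis ℝ (Gr V) j

/-- Smoothness on a set of a function with values in a finite-dimensional Grassmann algebra:
all its real coordinates are smooth. -/
def Gr.SmoothOn {F : Type*} [NormedAddCommGroup F] [NormedSpace ℝ F]
    (f : F → Gr V) (s : Set F) : Prop :=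
  ∀ c : Gr V →ₗ[ℝ] ℝ, ContDiffOn ℝ ∞ (fun y => c (f y)) s

theorem Gr.SmoothOn.add {F : Type*} [NormedAddCommGroup F] [NormedSpace ℝ F]
    {f g : F → Gr V} {s : Set F} (hf : Gr.SmoothOn f s) (hg : Gr.SmoothOn g s) :
    Gr.SmoothOn (fun y => f y + g y) s := fun c => by
  simpa using (hf c).add (hg c)

theorem Gr.SmoothOn.linear {F : Type*} [NormedAddCommGroup F] [NormedSpace ℝ F]
    {f : F → Gr V} {s : Set F} (hf : Gr.SmoothOn f s) (T : Gr V →ₗ[ℝ] Gr W) :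
    Gr.SmoothOn (fun y => T (f y)) s := fun c => hf (c ∘ₗ T)

theorem Gr.SmoothOn.mul [Module.Finite ℝ V] {F : Type*} [NormedAddCommGroup F]
    [NormedSpace ℝ F] {f g : F → Gr V} {s : Set F}
    (hf : Gr.SmoothOn f s) (hg : Gr.SmoothOn g s) :
    Gr.SmoothOn (fun y => f y * g y) s := fun c => by
  set b := Module.finBasis ℝ (Gr V)
  have key : ∀ y, c (f y * g y) =
      ∑ i, ∑ j, (b.coord i (f y) * b.coord j (g y)) * c (b i * b j) := fun y => by
    conv_lhs => rw [← b.sum_repr (f y), ← b.sum_repr (g y)]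
    simp only [Finset.sum_mul_sum, map_sum, smul_mul_smul_comm, map_smul, smul_eq_mul,
      Module.Basis.coord_apply]
  simp only [key]
  exact ContDiffOn.sum fun i _ => ContDiffOn.sum fun j _ =>
    ((hf _).mul (hg _)).mul contDiffOn_const

theorem Gr.gen_anticomm (x : Gr V) (v : V) : x * Gr.gen v = Gr.gen v * Gr.parity x := by
  induction x using TensorProduct.induction_on with
  | zero => simp
  | add x y hx hy => simp [add_mul, mul_add, hx, hy]
  | tmul z w =>
    have h : w * ExteriorAlgebra.ι ℝ v =
        ExteriorAlgebra.ι ℝ v * ExteriorAlgebra.map (-LinearMap.id) w := by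
      induction w using ExteriorAlgebra.induction with
      | algebraMap r => simp [Algebra.commutes]
      | ι u =>
        have := ExteriorAlgebra.ι_add_mul_swap (R := ℝ) u v
        simpa using eq_neg_of_add_eq_zero_left this
      | mul a b ha hb => rw [mul_assoc, hb, ← mul_assoc, ha, map_mul, mul_assoc]
      | add a b ha hb => rw [add_mul, ha, hb, map_add, mul_add]
    simp [Gr.gen, Gr.parity, Gr.map, h]

/-- Even elements are central. -/
theorem Gr.even_comm {x : Gr V} (hx : Gr.parity x = x) (y : Gr V) : x * y = y * x := by
  induction y using TensorProduct.induction_on with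
  | zero => simp
  | add a b ha hb => simp [add_mul, mul_add, ha, hb]
  | tmul z w =>
    have h : ∀ w : ExteriorAlgebra ℝ V, x * (1 ⊗ₜ[ℝ] w) = (1 ⊗ₜ[ℝ] w) * x := fun w => by
      induction w using ExteriorAlgebra.induction with
      | algebraMap r =>
        have : ((1 : ℂ) ⊗ₜ[ℝ] algebraMap ℝ (ExteriorAlgebra ℝ V) r : Gr V) =
            algebraMap ℝ (Gr V) r := by
          rw [Algebra.TensorProduct.algebraMap_apply, Algebra.algebraMap_eq_smul_one,
            Algebra.algebraMap_eq_smul_one, TensorProduct.smul_tmul]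
        rw [this, Algebra.commutes]
      | ι u => simpa [Gr.gen, hx] using Gr.gen_anticomm x u
      | mul a b ha hb =>
        have : ((1 : ℂ) ⊗ₜ[ℝ] (a * b) : Gr V) = (1 ⊗ₜ[ℝ] a) * (1 ⊗ₜ[ℝ] b) := by simp
        rw [this, ← mul_assoc, ha, mul_assoc, hb, mul_assoc]
      | add a b ha hb => rw [TensorProduct.tmul_add, mul_add, ha, hb, add_mul]
    have hz : (z ⊗ₜ[ℝ] w : Gr V) = z • (1 ⊗ₜ[ℝ] w) := by
      rw [TensorProduct.smul_tmul', smul_eq_mul, mul_one]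
    rw [hz, mul_smul_comm, h w, smul_mul_assoc]

end Grassmann

/-! ### Based lattices -/

/-- The manifold `L` of oriented based lattices `(ℓ, ℓ')` in `ℂ`, with `ℓ' / ℓ` in the upper half
plane. -/
def Lat : Set (ℂ × ℂ) := {p | 0 < (p.2 / p.1).im}

theorem mem_Lat_iff (p : ℂ × ℂ) : p ∈ Lat ↔ 0 < (starRingEnd ℂ p.1 * p.2).im := by
  rcases eq_or_ne p.1 0 with h | h
  · simp [Lat, h]
  · have hp : 0 < Complex.normSq p.1 := Complex.normSq_pos.2 h
    have h1 : p.2 / p.1 = (starRingEnd ℂ p.1 * p.2) * ((Complex.normSq p.1)⁻¹ : ℝ) := by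
      rw [div_eq_mul_inv, Complex.inv_def]; ring
    show 0 < (p.2 / p.1).im ↔ _
    rw [h1, Complex.im_mul_ofReal]
    exact ⟨fun H => (pos_iff_pos_of_mul_pos H).2 (inv_pos.2 hp),
      fun H => mul_pos H (inv_pos.2 hp)⟩

/-- The action of `SL₂(ℤ) × ℂˣ` on lattices,
`(ℓ, ℓ') ↦ (q² (a ℓ + b ℓ'), q² (c ℓ + d ℓ'))`. -/
def Lat.act (γ : Matrix.SpecialLinearGroup (Fin 2) ℤ) (q : ℂˣ) (Λ : Lat) : Lat :=
  ⟨((q : ℂ) ^ 2 * (γ 0 0 * Λ.1.1 + γ 0 1 * Λ.1.2), (q : ℂ) ^ 2 * (γ 1 0 * Λ.1.1 + γ 1 1 * Λ.1.2)), by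
    obtain ⟨⟨l, l'⟩, h⟩ := Λ
    rw [mem_Lat_iff] at h ⊢
    have hdet : (γ 0 0 * γ 1 1 - γ 0 1 * γ 1 0 : ℤ) = 1 := by
      rw [← Matrix.det_fin_two]; exact γ.2
    have hdet' : (γ 0 0 * γ 1 1 - γ 0 1 * γ 1 0 : ℝ) = 1 := by exact_mod_cast hdet
    have hq : 0 < Complex.normSq ((q : ℂ) ^ 2) := Complex.normSq_pos.2 (pow_ne_zero _ q.ne_zero)
    have key : (starRingEnd ℂ ((q : ℂ) ^ 2 * (γ 0 0 * l + γ 0 1 * l')) *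
        ((q : ℂ) ^ 2 * (γ 1 0 * l + γ 1 1 * l'))).im =
        Complex.normSq ((q : ℂ) ^ 2) * ((γ 0 0 * γ 1 1 - γ 0 1 * γ 1 0 : ℝ) *
          (starRingEnd ℂ l * l').im) := by
      generalize (q : ℂ) ^ 2 = r
      simp [Complex.normSq_apply]
      ring
    simp only at h ⊢
    rw [key, hdet', one_mul]
    exact mul_pos hq h⟩

/-! ### Functions on `L × πTX` -/

/-- The model vector space. -/
abbrev Euc (n : ℕ) : Type := EuclideanSpace ℝ (Fin n)

/-- The fibre `ℂ ⊗ Λ•(T*ₓX)` of the structure sheaf of `πTX`. Cotangent vectors at `x` are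
expressed in the preferred chart at `x`, exactly as in Mathlib's `TangentSpace`. -/
abbrev Form (n : ℕ) : Type := Gr (Module.Dual ℝ (Euc n))

section Functions

variable {n : ℕ} {X : Type*} [TopologicalSpace X] [ChartedSpace (Euc n) X]

/-- The expression, in the chart at `x₀`, of a family of inhomogeneous complex differential forms
on `X` parametrized by lattices: a function of `(ℓ, ℓ')` and of the coordinates `z`. (It is extended
by zero to pairs `(ℓ, ℓ')` which are not in `L`.) -/
def inChart [IsManifold (𝓡 n) ∞ X] (f : Lat → X → Form n) (x₀ : X) (p : (ℂ × ℂ) × Euc n) :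
    Form n :=
  let y := (extChartAt (𝓡 n) x₀).symm p.2
  Gr.map ((tangentCoordChange (𝓡 n) x₀ y y).toLinearMap.dualMap)
    (Function.extend (Subtype.val : Lat → ℂ × ℂ) (fun Λ => f Λ y) 0 p.1)

/-- `f` belongs to `C^∞(L × πTX)`, i.e. it is a family of inhomogeneous complex differential forms
on `X` which depends smoothly on the point of `L × X`. -/
def IsSmooth [IsManifold (𝓡 n) ∞ X] (f : Lat → X → Form n) : Prop :=
  ∀ x₀ : X, Gr.SmoothOn (inChart f x₀) (Lat ×ˢ (extChartAt (𝓡 n) x₀).target)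

/-- The de Rham differential along `X`, `d f = ∑ᵢ dzⁱ ∧ ∂f/∂zⁱ` in the chart at the given point. -/
def dX [IsManifold (𝓡 n) ∞ X] (f : Lat → X → Form n) (Λ : Lat) (x : X) : Form n :=
  ∑ i : Fin n, Gr.gen (EuclideanSpace.proj (𝕜 := ℝ) i : Euc n →L[ℝ] ℝ).toLinearMap *
    Gr.deriv (fun z => inChart f x (Λ.1, z)) (extChartAt (𝓡 n) x x) (EuclideanSpace.single i 1)

/-- The derivative of `f` in the direction `w` of the space of lattices, at fixed `x`. -/
def dLat (f : Lat → X → Form n) (w : ℂ × ℂ) (Λ : Lat) (x : X) : Form n :=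
  Gr.deriv (Function.extend (Subtype.val : Lat → ℂ × ℂ) (fun Λ => f Λ x) 0) Λ.1 w

/-- `∂/∂ℓ̄ = (∂/∂Re ℓ + i ∂/∂Im ℓ) / 2`. -/
def dbar (f : Lat → X → Form n) (Λ : Lat) (x : X) : Form n :=
  (1 / 2 : ℂ) • (dLat f (1, 0) Λ x + Complex.I • dLat f (Complex.I, 0) Λ x)

/-- `∂/∂ℓ̄' = (∂/∂Re ℓ' + i ∂/∂Im ℓ') / 2`. -/
def dbar' (f : Lat → X → Form n) (Λ : Lat) (x : X) : Form n :=
  (1 / 2 : ℂ) • (dLat f (0, 1) Λ x + Complex.I • dLat f (0, Complex.I) Λ x)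

end Functions

/-! ### The groupoids

The stack `Φ_ε(X)` is presented by `(sL × πTX) // (Γ × (ℝ^{2|1} ⋊ ℂˣ))` with `Γ = SL₂(ℤ)`, and its
cover by the same with `Γ` trivial. Points of `sL` are `(ℓ, ℓ̄, σ, ℓ', ℓ̄', σ')` with `σ σ' = 0`, and
points of `πTX` are maps `φ₀ = x + θ ψ` from `ℝ^{0|1}` to `X`; a function on `sL × πTX` is
`F₀ + σ F₁ + σ' F₂` with `F₀, F₁, F₂` in `C^∞(L × πTX)`. The locus `σ = σ' = 0` presents the stack of
classical vacua `Φ₀(X)`, or its cover. A function on a stack is a function on the objects of the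
groupoid whose pullbacks along the source map and the target map (the action) agree.

Below, `u` and `q` are the even coordinates on `ℝ^{2|1} ⋊ ℂˣ`, and the odd coordinates `ν, σ, σ'` are
adjoined to the fibre `ℂ ⊗ Λ•(T*ₓX)` as further odd generators. -/

/-- The algebra of complex differential forms at a point with the odd parameters `ν, σ, σ'`
adjoined. -/
abbrev ParamForm (n : ℕ) : Type := Gr ((Fin 3 → ℝ) × Module.Dual ℝ (Euc n))

section Action

variable {n : ℕ}

/-- The odd coordinate on the group `ℝ^{2|1}`. -/
def ν : ParamForm n := Gr.gen (Pi.single 0 1, 0)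

/-- The odd coordinate `σ` on `sL`. -/
def σ : ParamForm n := Gr.gen (Pi.single 1 1, 0)

/-- The odd coordinate `σ'` on `sL`. -/
def σ' : ParamForm n := Gr.gen (Pi.single 2 1, 0)

/-- Forms as elements of the extended algebra. -/
def incl : Form n →ₐ[ℂ] ParamForm n := Gr.map (LinearMap.inr ℝ _ _)

variable {X : Type*} [TopologicalSpace X] [ChartedSpace (Euc n) X] [IsManifold (𝓡 n) ∞ X]

/-- The value of `f` at the point `(Λ, x + e ψ, c ψ)`, with `e` odd and `c` even, which is obtained
from the tautological point `(Λ, x, ψ)` by precomposing `φ₀ = x + θ ψ` with `θ ↦ c θ + e`. It is the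
algebra map determined by `g ↦ g + e dg`, `dg ↦ c dg` for `g ∈ C^∞(X)`, so that it sends a form `α`
of degree `k` to `c ^ k (α + e dα)`. -/
def affineValue (c e : ParamForm n) (f : Lat → X → Form n) (Λ : Lat) (x : X) : ParamForm n :=
  ∑ k ∈ Finset.range (n + 1),
    c ^ k * (incl (Gr.comp k (f Λ x)) + e * incl (Gr.comp (k + 1) (dX f Λ x)))

/-- The value of `f` at the point with lattice `(ℓ, ℓ̄ + m, ℓ', ℓ̄' + m')` over `Λ = (ℓ, ℓ')`, and with
`(x + e ψ, c ψ)` as in `affineValue`; here `m, m'` are even with `m² = m m' = m'² = 0`, so that the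
Taylor expansion stops at first order. -/
def shiftedValue (m m' c e : ParamForm n) (f : Lat → X → Form n) (Λ : Lat) (x : X) :
    ParamForm n :=
  affineValue c e f Λ x + m * affineValue c e (dbar f) Λ x + m' * affineValue c e (dbar' f) Λ x

/-- The pullback of the function `F₀ + σ F₁ + σ' F₂` on `sL × πTX` along the action of
`SL₂(ℤ) × (ℝ^{2|1} ⋊ ℂˣ)`, at the body `(γ, u, q; Λ, x)`.

The group element `(γ, (u, ū, ν), q)` acts on `ℝ^{2|1}` by left translation followed by dilation. It
maps the torus of `(ℓ, ℓ̄, σ, ℓ', ℓ̄', σ')` to the torus with first basis vector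
`(q² (aℓ + bℓ'), q̄² (a (ℓ̄ + 2iνσ) + b (ℓ̄' + 2iνσ')), q̄ (aσ + bσ'))`
and second basis vector given by the same formula with `c, d`. It covers, along the projections
`proj_Λ (z, z̄, θ) = θ - ((σ ℓ' - σ' ℓ) z̄ - (σ ℓ̄' - σ' ℓ̄) z) / V` with `V = ℓ̄ ℓ' - ℓ̄' ℓ`, the affine map
`θ ↦ q̄ ((1 - i s ν / V) θ + b)` with `s = σ ℓ' - σ' ℓ`, `s̄ = σ ℓ̄' - σ' ℓ̄` and
`b = ν - (s ū - s̄ u) / V`; a map `φ₀` is sent to its composite with the inverse of this affine map,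
`θ ↦ (1 + i s ν / V) (q̄⁻¹ θ - b)`. -/
def actPullback (F₀ F₁ F₂ : Lat → X → Form n) (γ : Matrix.SpecialLinearGroup (Fin 2) ℤ)
    (q : ℂˣ) (u : ℂ) (Λ : Lat) (x : X) : ParamForm n :=
  let l : ℂ := Λ.1.1
  let l' : ℂ := Λ.1.2
  let lbar : ℂ := starRingEnd ℂ l
  let lbar' : ℂ := starRingEnd ℂ l'
  let qbar : ℂ := starRingEnd ℂ (q : ℂ)
  let V : ℂ := lbar * l' - lbar' * l
  let s : ParamForm n := l' • σ - l • σ'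
  let sbar : ParamForm n := lbar' • σ - lbar • σ'
  let b : ParamForm n := ν - V⁻¹ • (starRingEnd ℂ u • s - u • sbar)
  let a' : ParamForm n := 1 + (Complex.I / V) • (s * ν)
  let m : ParamForm n := (qbar ^ 2 * 2 * Complex.I) • (ν * ((γ 0 0 : ℂ) • σ + (γ 0 1 : ℂ) • σ'))
  let m' : ParamForm n := (qbar ^ 2 * 2 * Complex.I) • (ν * ((γ 1 0 : ℂ) • σ + (γ 1 1 : ℂ) • σ'))
  let val : (Lat → X → Form n) → ParamForm n := fun f =>
    shiftedValue m m' (qbar⁻¹ • a') (-(a' * b)) f (Lat.act γ q Λ) x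
  val F₀ + (qbar • ((γ 0 0 : ℂ) • σ + (γ 0 1 : ℂ) • σ')) * val F₁ +
    (qbar • ((γ 1 0 : ℂ) • σ + (γ 1 1 : ℂ) • σ')) * val F₂

/-- The pullback of `F₀ + σ F₁ + σ' F₂` along the projection to `sL × πTX`. -/
def projPullback (F₀ F₁ F₂ : Lat → X → Form n) (Λ : Lat) (x : X) : ParamForm n :=
  incl (F₀ Λ x) + σ * incl (F₁ Λ x) + σ' * incl (F₂ Λ x)

/-- `F₀ + σ F₁ + σ' F₂` is a function on `Φ_ε(X)` (for `Γ = ⊤`), or on its cover (for `Γ = ⊥`): it is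
smooth and invariant under `Γ × (ℝ^{2|1} ⋊ ℂˣ)`. Since `σ σ' = 0` on `sL`, the equality is modulo the
ideal generated by `σ σ'`. -/
def IsFunctionOnEps (Γ : Subgroup (Matrix.SpecialLinearGroup (Fin 2) ℤ))
    (F₀ F₁ F₂ : Lat → X → Form n) : Prop :=
  IsSmooth F₀ ∧ IsSmooth F₁ ∧ IsSmooth F₂ ∧
    ∀ γ ∈ Γ, ∀ (q : ℂˣ) (u : ℂ) (Λ : Lat) (x : X),
      actPullback F₀ F₁ F₂ γ q u Λ x - projPullback F₀ F₁ F₂ Λ x ∈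
        Ideal.span {(σ * σ' : ParamForm n)}

/-- `f` is a function on the stack `Φ₀(X)` of classical vacua (for `Γ = ⊤`), or on its
`SL₂(ℤ)`-cover (for `Γ = ⊥`): the same invariance on the locus `σ = σ' = 0`. -/
def IsFunctionOnVacua (Γ : Subgroup (Matrix.SpecialLinearGroup (Fin 2) ℤ))
    (f : Lat → X → Form n) : Prop :=
  IsSmooth f ∧
    ∀ γ ∈ Γ, ∀ (q : ℂˣ) (u : ℂ) (Λ : Lat) (x : X),
      actPullback f 0 0 γ q u Λ x - projPullback f 0 0 Λ x ∈
        Ideal.span {(σ : ParamForm n), σ'}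

/-- `f` is a supersymmetric function on `Φ₀(X)` (for `Γ = ⊤`), or on its cover (for `Γ = ⊥`): it is
a function on `Φ₀(X)` in the image of the restriction `C^∞(Φ_ε(X)) → C^∞(Φ₀(X))`. -/
def IsSusy (Γ : Subgroup (Matrix.SpecialLinearGroup (Fin 2) ℤ)) (f : Lat → X → Form n) : Prop :=
  IsFunctionOnVacua Γ f ∧ ∃ F₁ F₂ : Lat → X → Form n, IsFunctionOnEps Γ f F₁ F₂

end Action

/-! ### Metrized line bundles -/

section LineBundles

variable (n : ℕ) (X : Type*) [TopologicalSpace X] [ChartedSpace (Euc n) X]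
  [IsManifold (𝓡 n) ∞ X]

variable {n X} in
theorem inChart_add (f g : Lat → X → Form n) (x₀ : X) (p : (ℂ × ℂ) × Euc n) :
    inChart (f + g) x₀ p = inChart f x₀ p + inChart g x₀ p := by
  by_cases h : p.1 ∈ Lat
  · have e : p.1 = ((⟨p.1, h⟩ : Lat) : ℂ × ℂ) := rfl
    simp only [inChart]
    rw [e, Subtype.val_injective.extend_apply, Subtype.val_injective.extend_apply,
      Subtype.val_injective.extend_apply, ← map_add]
    rfl
  · have e : ¬ ∃ a : Lat, (a : ℂ × ℂ) = p.1 := fun ⟨a, ha⟩ => h (ha ▸ a.2)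
    simp [inChart, Function.extend_apply' _ _ _ e]

variable {n X} in
theorem inChart_mul (f g : Lat → X → Form n) (x₀ : X) (p : (ℂ × ℂ) × Euc n) :
    inChart (f * g) x₀ p = inChart f x₀ p * inChart g x₀ p := by
  by_cases h : p.1 ∈ Lat
  · have e : p.1 = ((⟨p.1, h⟩ : Lat) : ℂ × ℂ) := rfl
    simp only [inChart]
    rw [e, Subtype.val_injective.extend_apply, Subtype.val_injective.extend_apply,
      Subtype.val_injective.extend_apply, ← map_mul]
    rfl
  · have e : ¬ ∃ a : Lat, (a : ℂ × ℂ) = p.1 := fun ⟨a, ha⟩ => h (ha ▸ a.2)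
    simp [inChart, Function.extend_apply' _ _ _ e]

theorem isSmooth_const (c : ℂ) :
    IsSmooth (algebraMap ℂ (Lat → X → Form n) c) := fun x₀ l => by
  refine (contDiffOn_const (c := l (algebraMap ℂ (Form n) c))).congr fun p hp => ?_
  have e : p.1 = ((⟨p.1, hp.1⟩ : Lat) : ℂ × ℂ) := rfl
  simp only [inChart]
  rw [e, Subtype.val_injective.extend_apply]
  exact congrArg l (AlgHom.commutes _ c)

theorem Gr.map_conj {V W : Type*} [AddCommGroup V] [Module ℝ V] [AddCommGroup W] [Module ℝ W]
    (f : V →ₗ[ℝ] W) (x : Gr V) : Gr.map f (Gr.conj x) = Gr.conj (Gr.map f x) := by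
  induction x using TensorProduct.induction_on with
  | zero => simp
  | add a b ha hb => simp [ha, hb]
  | tmul z w => simp [Gr.map, Gr.conj]

variable {n X} in
theorem inChart_conj (f : Lat → X → Form n) (x₀ : X) (p : (ℂ × ℂ) × Euc n) :
    inChart (fun Λ x => Gr.conj (f Λ x)) x₀ p = Gr.conj (inChart f x₀ p) := by
  by_cases h : p.1 ∈ Lat
  · have e : p.1 = ((⟨p.1, h⟩ : Lat) : ℂ × ℂ) := rfl
    simp only [inChart]
    rw [e, Subtype.val_injective.extend_apply, Subtype.val_injective.extend_apply, Gr.map_conj]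
  · have e : ¬ ∃ a : Lat, (a : ℂ × ℂ) = p.1 := fun ⟨a, ha⟩ => h (ha ▸ a.2)
    simp [inChart, Function.extend_apply' _ _ _ e]

/-- The subalgebra of even functions on the supermanifold `L × πTX`. -/
def evenSubalgebra : Subalgebra ℂ (Lat → X → Form n) where
  carrier := {f | IsSmooth f ∧ ∀ Λ x, Gr.parity (f Λ x) = f Λ x}
  mul_mem' := fun hf hg =>
    ⟨fun x₀ => by
      rw [show inChart (_ * _) x₀ = fun p => inChart _ x₀ p * inChart _ x₀ p from
        funext (inChart_mul _ _ x₀)]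
      exact (hf.1 x₀).mul (hg.1 x₀), fun Λ x => by simp [hf.2 Λ x, hg.2 Λ x]⟩
  add_mem' := fun hf hg =>
    ⟨fun x₀ => by
      rw [show inChart (_ + _) x₀ = fun p => inChart _ x₀ p + inChart _ x₀ p from
        funext (inChart_add _ _ x₀)]
      exact (hf.1 x₀).add (hg.1 x₀), fun Λ x => by simp [hf.2 Λ x, hg.2 Λ x]⟩
  algebraMap_mem' := fun c =>
    ⟨isSmooth_const n X c, fun _ _ => AlgHom.commutes _ c⟩

/-- The commutative algebra of even functions on the supermanifold `L × πTX`. (Functions on `Φ₀(X)`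
and its cover are automatically even, because the dilation `q = -1` acts on `L × πTX` as the parity
involution.) -/
def EvenFun : Type _ := evenSubalgebra n X

instance : CommRing (EvenFun n X) :=
  let r : Ring (evenSubalgebra n X) := inferInstance
  { r with
    mul_comm := fun f g => Subtype.ext (funext fun Λ => funext fun x =>
      Gr.even_comm (f.2.2 Λ x) (g.1 Λ x)) }

instance : Algebra ℂ (EvenFun n X) :=
  RingHom.toAlgebra
    { toFun := fun c => ⟨algebraMap ℂ (Lat → X → Form n) c, (evenSubalgebra n X).algebraMap_mem c⟩
      map_one' := Subtype.ext (map_one _)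
      map_mul' := fun _ _ => Subtype.ext (map_mul _ _ _)
      map_zero' := Subtype.ext (map_zero _)
      map_add' := fun _ _ => Subtype.ext (map_add _ _ _) }

variable {n X}

/-- Complex conjugation of even functions on `L × πTX`. -/
def EvenFun.conj (f : EvenFun n X) : EvenFun n X :=
  ⟨fun Λ x => Gr.conj (f.1 Λ x), fun x₀ => by
    rw [show inChart (fun Λ x => Gr.conj (f.1 Λ x)) x₀ = fun p => Gr.conj (inChart f.1 x₀ p) from
      funext (inChart_conj f.1 x₀)]
    exact (f.2.1 x₀).linear Gr.conj.toLinearMap,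
   fun Λ x => by
    show Gr.map _ (Gr.conj _) = _
    rw [Gr.map_conj]
    exact congrArg Gr.conj (f.2.2 Λ x)⟩

/-- The value of an even function at a point of the reduced manifold `L × X`. -/
def EvenFun.eval (Λ : Lat) (x : X) : EvenFun n X →+* ℂ where
  toFun f := Gr.body (f.1 Λ x)
  map_one' := map_one _
  map_mul' f g := map_mul Gr.body (f.1 Λ x) (g.1 Λ x)
  map_zero' := map_zero _
  map_add' f g := map_add Gr.body (f.1 Λ x) (g.1 Λ x)

/-- The section `e` of the line bundle with module of sections `E` does not vanish at the point
`(Λ, x)` of the reduced manifold, i.e. its class in the fibre `E / 𝔪 E` is nonzero. -/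
def NonvanishingAt {E : Type*} [AddCommGroup E] [Module (EvenFun n X) E] (e : E) (Λ : Lat)
    (x : X) : Prop :=
  e ∉ (RingHom.ker (EvenFun.eval (n := n) Λ x)) • (⊤ : Submodule (EvenFun n X) E)

variable (n X)

/-- A metrized line bundle on the supermanifold `L × πTX`: an invertible module `E` over the even
functions (the even sections) with a positive definite hermitian form with values in functions. -/
structure MetrizedLineBundle where
  /-- The module of even sections. -/
  E : Type*
  [addCommGroup : AddCommGroup E]
  [module : Module (EvenFun n X) E]
  [invertible : Module.Invertible (EvenFun n X) E]
  /-- The hermitian form. -/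
  inner : E → E → EvenFun n X
  inner_add_left : ∀ e₁ e₂ e, inner (e₁ + e₂) e = inner e₁ e + inner e₂ e
  inner_smul_left : ∀ (a : EvenFun n X) (e₁ e₂ : E), inner (a • e₁) e₂ = a * inner e₁ e₂
  inner_conj : ∀ e₁ e₂, inner e₂ e₁ = EvenFun.conj (inner e₁ e₂)
  inner_pos : ∀ (e : E) (Λ : Lat) (x : X), NonvanishingAt (n := n) e Λ x →
    0 < (EvenFun.eval Λ x (inner e e)).re

attribute [instance] MetrizedLineBundle.addCommGroup MetrizedLineBundle.module
  MetrizedLineBundle.invertible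

/-- A metrized line bundle with preferred nonvanishing section on `Φ₀(X)` (for `Γ = ⊤`), or on its
cover (for `Γ = ⊥`).

A line bundle on the stack is a line bundle on the objects `L × πTX` of the groupoid together with
an isomorphism between its pullbacks along the source and target maps which satisfies the cocycle
condition; a section of it is a section over `L × πTX` which this isomorphism preserves, and the
metric has to be preserved as well. A nonvanishing section `sec` freely generates the line bundle, so
there is exactly one such isomorphism which preserves `sec`, namely `f sec ↦ f sec`, and it
automatically satisfies the cocycle condition. The only condition which remains is the invariance
of the metric: the norm squared of `sec` is a function on the stack. A section `f sec` descends to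
the stack exactly when `f` does. -/
structure VacuaLineBundle (Γ : Subgroup (Matrix.SpecialLinearGroup (Fin 2) ℤ)) extends
    MetrizedLineBundle n X where
  /-- The preferred section. -/
  sec : E
  sec_nonvanishing : ∀ (Λ : Lat) (x : X), NonvanishingAt (n := n) sec Λ x
  inner_sec_invariant : IsFunctionOnVacua Γ (inner sec sec).1

variable {n X}

/-- A supersymmetric trivialization of `(𝓛, sec)`: a section of unit norm of the form `f sec` with
`f` a supersymmetric function. -/
def VacuaLineBundle.IsSusyTrivialization {Γ : Subgroup (Matrix.SpecialLinearGroup (Fin 2) ℤ)}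
    (𝓛 : VacuaLineBundle n X Γ) (s : 𝓛.E) : Prop :=
  (∃ f : EvenFun n X, IsSusy Γ f.1 ∧ s = f • 𝓛.sec) ∧ 𝓛.inner s s = 1

end LineBundles

end ClassicalVacua

end

/-! Only group elements with trivial `SL₂(ℤ)` part are needed, so the stack and its cover are
treated together. Let `F₀ + σ F₁ + σ' F₂` be invariant. With all odd parameters zero, the dilations
show that the degree `k` part of `F₀` has weight `q̄ᵏ` (`IsFunctionOnEps.comp_act`). The odd
translation `ν` does the rest. It moves `ℓ̄, ℓ̄'` by `2iνσ, 2iνσ'` and `x` by a multiple of `νψ`.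
Reading off the coefficients of `νσ`, `νσ'` and `ν dzⁱ` modulo forms of higher degree shows that the
degree zero part, the body, is holomorphic on `Lat` and constant along the connected `X`.

On the connected `Lat`, a holomorphic function of modulus one is constant by the maximum principle,
and a real one reduces to this by a Cayley transform. It remains to control positive degrees. For
real `F₀`, a dilation with `q̄ᵏ = i` multiplies the real degree `k` part by `i` and yet keeps it
real, so it vanishes.

For two trivializations `f s₀`, `g s₀`, unit norm gives `f f̄ = g ḡ`. The products `fᵢ f̄ⱼ` have the
pairwise distinct weights `q̄ⁱ qʲ`, so by independence of characters `fᵢ f̄ⱼ = gᵢ ḡⱼ` for each `i,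
j`. The case `j = 0` gives `f̄₀ f = ḡ₀ g`. Since `g₀ / f₀` is a constant phase `c`, it follows that
`g = c f`. -/

noncomputable section

namespace ClassicalVacua

/-! ### Grassmann algebras: functoriality, grading, body and coefficient extraction. -/

section GradedComponents

variable {V W U : Type*} [AddCommGroup V] [Module ℝ V] [AddCommGroup W] [Module ℝ W]
  [AddCommGroup U] [Module ℝ U]

theorem Gr.map_gen (f : V →ₗ[ℝ] W) (v : V) : Gr.map f (Gr.gen v) = Gr.gen (f v) := by
  simp [Gr.map, Gr.gen]

theorem Gr.map_map (g : W →ₗ[ℝ] U) (f : V →ₗ[ℝ] W) (x : Gr V) :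
    Gr.map g (Gr.map f x) = Gr.map (g ∘ₗ f) x := by
  induction x using TensorProduct.induction_on with
  | zero => simp
  | add a b ha hb => simp [ha, hb]
  | tmul z w =>
    have := DFunLike.congr_fun (ExteriorAlgebra.map_comp_map f g) w
    simp only [AlgHom.comp_apply] at this
    simp [Gr.map, this]

theorem Gr.map_id (x : Gr V) : Gr.map LinearMap.id x = x := by
  induction x using TensorProduct.induction_on with
  | zero => simp
  | add a b ha hb => simp [ha, hb]
  | tmul z w => simp [Gr.map, ExteriorAlgebra.map_id]

theorem Gr.gen_mul_gen_self (v : V) : Gr.gen v * Gr.gen v = 0 := by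
  simp [Gr.gen]

theorem Gr.gen_mul_gen_add_swap (v w : V) : Gr.gen v * Gr.gen w + Gr.gen w * Gr.gen v = 0 := by
  rw [Gr.gen, Gr.gen, Algebra.TensorProduct.tmul_mul_tmul, Algebra.TensorProduct.tmul_mul_tmul,
    ← TensorProduct.tmul_add, ExteriorAlgebra.ι_add_mul_swap, TensorProduct.tmul_zero]

theorem Gr.gen_zero : Gr.gen (0 : V) = 0 := by simp [Gr.gen]

theorem exteriorAlgebra_algebraMapInv_map (f : V →ₗ[ℝ] W) (w : ExteriorAlgebra ℝ V) :
    ExteriorAlgebra.algebraMapInv (ExteriorAlgebra.map f w) = ExteriorAlgebra.algebraMapInv w := by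
  have : (ExteriorAlgebra.algebraMapInv (R := ℝ) (M := W)).comp (ExteriorAlgebra.map f) =
      ExteriorAlgebra.algebraMapInv := by
    ext v; simp [ExteriorAlgebra.algebraMapInv]
  exact DFunLike.congr_fun this w

theorem Gr.body_tmul (z : ℂ) (w : ExteriorAlgebra ℝ V) :
    Gr.body (z ⊗ₜ[ℝ] w : Gr V) = z * ((ExteriorAlgebra.algebraMapInv w : ℝ) : ℂ) := by
  simp [Gr.body, Algebra.ofId_apply]

theorem Gr.body_map (f : V →ₗ[ℝ] W) (x : Gr V) : Gr.body (Gr.map f x) = Gr.body x := by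
  induction x using TensorProduct.induction_on with
  | zero => simp
  | add a b ha hb => simp [ha, hb]
  | tmul z w =>
    simp only [Gr.map, Algebra.TensorProduct.map_tmul, Gr.body_tmul,
      exteriorAlgebra_algebraMapInv_map, AlgHom.id_apply]

theorem Gr.body_conj (x : Gr V) : Gr.body (Gr.conj x) = starRingEnd ℂ (Gr.body x) := by
  induction x using TensorProduct.induction_on with
  | zero => simp
  | add a b ha hb => simp [ha, hb]
  | tmul z w => simp [Gr.conj, Gr.body_tmul]

theorem Gr.conj_smul (z : ℂ) (x : Gr V) : Gr.conj (z • x) = starRingEnd ℂ z • Gr.conj x := by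
  induction x using TensorProduct.induction_on with
  | zero => simp
  | add a b ha hb => simp [ha, hb]
  | tmul y w => simp [Gr.conj, TensorProduct.smul_tmul']

theorem Gr.comp_tmul (k : ℕ) (z : ℂ) (w : ExteriorAlgebra ℝ V) :
    Gr.comp k (z ⊗ₜ[ℝ] w : Gr V) =
      z ⊗ₜ[ℝ] GradedAlgebra.proj (fun i : ℕ => ⋀[ℝ]^i V) k w := rfl

theorem exteriorAlgebra_map_mem (f : V →ₗ[ℝ] W) {i : ℕ} {w : ExteriorAlgebra ℝ V}
    (hw : w ∈ ⋀[ℝ]^i V) : ExteriorAlgebra.map f w ∈ ⋀[ℝ]^i W := by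
  have h := Submodule.mem_map_of_mem (f := (ExteriorAlgebra.map f).toLinearMap) hw
  rw [ExteriorAlgebra.exteriorPower, Submodule.map_pow] at h
  have hle : (LinearMap.range (ExteriorAlgebra.ι ℝ (M := V))).map
      (ExteriorAlgebra.map f).toLinearMap ≤ LinearMap.range (ExteriorAlgebra.ι ℝ (M := W)) := by
    rintro _ ⟨_, ⟨v, rfl⟩, rfl⟩
    exact ⟨f v, by simp⟩
  exact pow_le_pow_left' hle i h

theorem exteriorAlgebra_proj_map (f : V →ₗ[ℝ] W) (k : ℕ) (w : ExteriorAlgebra ℝ V) :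
    GradedAlgebra.proj (fun i : ℕ => ⋀[ℝ]^i W) k (ExteriorAlgebra.map f w) =
      ExteriorAlgebra.map f (GradedAlgebra.proj (fun i : ℕ => ⋀[ℝ]^i V) k w) := by
  induction w using DirectSum.Decomposition.inductionOn (fun i : ℕ => ⋀[ℝ]^i V) with
  | zero => simp only [map_zero]
  | add a b ha hb => simp only [map_add, ha, hb]
  | @homogeneous i m =>
    have hm := exteriorAlgebra_map_mem f m.2
    rw [GradedAlgebra.proj_apply, GradedAlgebra.proj_apply]
    rcases eq_or_ne i k with rfl | h
    · rw [DirectSum.decompose_of_mem_same (fun i : ℕ => ⋀[ℝ]^i W) hm,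
        DirectSum.decompose_of_mem_same (fun i : ℕ => ⋀[ℝ]^i V) m.2]
    · rw [DirectSum.decompose_of_mem_ne (fun i : ℕ => ⋀[ℝ]^i W) hm h,
        DirectSum.decompose_of_mem_ne (fun i : ℕ => ⋀[ℝ]^i V) m.2 h, map_zero]

theorem Gr.comp_map (f : V →ₗ[ℝ] W) (k : ℕ) (x : Gr V) :
    Gr.comp k (Gr.map f x) = Gr.map f (Gr.comp k x) := by
  induction x using TensorProduct.induction_on with
  | zero => simp
  | add a b ha hb => simp only [map_add, ha, hb]
  | tmul z w =>
    simp only [Gr.map, Algebra.TensorProduct.map_tmul, Gr.comp_tmul, exteriorAlgebra_proj_map]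

theorem Gr.comp_conj (k : ℕ) (x : Gr V) : Gr.comp k (Gr.conj x) = Gr.conj (Gr.comp k x) := by
  induction x using TensorProduct.induction_on with
  | zero => simp
  | add a b ha hb => simp only [map_add, ha, hb]
  | tmul z w =>
    simp only [Gr.conj, Algebra.TensorProduct.map_tmul, Gr.comp_tmul, AlgHom.id_apply]

theorem Gr.comp_smul (k : ℕ) (z : ℂ) (x : Gr V) : Gr.comp k (z • x) = z • Gr.comp k x := by
  induction x using TensorProduct.induction_on with
  | zero => simp
  | add a b ha hb => simp only [map_add, smul_add, ha, hb]
  | tmul y w => simp only [TensorProduct.smul_tmul', Gr.comp_tmul]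

theorem Gr.comp_comp (j k : ℕ) (x : Gr V) :
    Gr.comp j (Gr.comp k x) = if j = k then Gr.comp k x else 0 := by
  induction x using TensorProduct.induction_on with
  | zero => simp
  | add a b ha hb => simp only [map_add, ha, hb]; split_ifs <;> simp
  | tmul z w =>
    simp only [Gr.comp_tmul, GradedAlgebra.proj_apply]
    split_ifs with h
    · subst h
      rw [DirectSum.decompose_of_mem_same (fun i : ℕ => ⋀[ℝ]^i V) (SetLike.coe_mem _)]
    · rw [DirectSum.decompose_of_mem_ne (fun i : ℕ => ⋀[ℝ]^i V) (SetLike.coe_mem _) (Ne.symm h), TensorProduct.tmul_zero]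

theorem exteriorAlgebra_proj_zero (w : ExteriorAlgebra ℝ V) :
    GradedAlgebra.proj (fun i : ℕ => ⋀[ℝ]^i V) 0 w =
      algebraMap ℝ _ (ExteriorAlgebra.algebraMapInv w) := by
  induction w using DirectSum.Decomposition.inductionOn (fun i : ℕ => ⋀[ℝ]^i V) with
  | zero => simp only [map_zero]
  | add a b ha hb => simp only [map_add, ha, hb]
  | @homogeneous i m =>
    obtain ⟨m, hm⟩ := m
    rw [GradedAlgebra.proj_apply]
    rcases i with _ | i
    · rw [DirectSum.decompose_of_mem_same (fun i : ℕ => ⋀[ℝ]^i V) hm]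
      rw [ExteriorAlgebra.exteriorPower, pow_zero, Submodule.mem_one] at hm
      obtain ⟨r, rfl⟩ := hm
      simp
    · rw [DirectSum.decompose_of_mem_ne (fun i : ℕ => ⋀[ℝ]^i V) hm (Nat.succ_ne_zero i)]
      rw [ExteriorAlgebra.exteriorPower, pow_succ] at hm
      induction hm using Submodule.mul_induction_on' with
      -- An element of positive degree is a sum of products ending in a vector, which the
      -- augmentation kills.
      | mem_mul_mem a _ b hb =>
        obtain ⟨v, rfl⟩ := hb
        simp [ExteriorAlgebra.algebraMapInv]
      | add a h₁ b h₂ ha hb => rw [map_add, map_add, ← ha h₁, ← hb h₂, add_zero]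

theorem Gr.comp_zero (x : Gr V) : Gr.comp 0 x = algebraMap ℂ (Gr V) (Gr.body x) := by
  induction x using TensorProduct.induction_on with
  | zero => simp
  | add a b ha hb => simp only [map_add, ha, hb]
  | tmul z w =>
    rw [Gr.comp_tmul, exteriorAlgebra_proj_zero, Gr.body_tmul,
      Algebra.TensorProduct.algebraMap_apply, Algebra.algebraMap_eq_smul_one (A := ExteriorAlgebra ℝ V),
      TensorProduct.tmul_smul, TensorProduct.smul_tmul', Algebra.algebraMap_self, RingHom.id_apply,
      mul_comm, Complex.real_smul]

theorem Gr.body_comp (k : ℕ) (x : Gr V) :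
    Gr.body (Gr.comp k x) = if k = 0 then Gr.body x else 0 := by
  have h : algebraMap ℂ (Gr V) (Gr.body (Gr.comp k x)) =
      algebraMap ℂ (Gr V) (if k = 0 then Gr.body x else 0) := by
    rw [← Gr.comp_zero, Gr.comp_comp]
    by_cases hk : k = 0
    · simp [hk, Gr.comp_zero]
    · simp [hk, Ne.symm hk]
  simpa only [AlgHom.commutes, Algebra.algebraMap_self, RingHom.id_apply] using congrArg Gr.body h

theorem Gr.comp_gen (k : ℕ) (v : V) : Gr.comp k (Gr.gen v) = if k = 1 then Gr.gen v else 0 := by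
  have hv : ExteriorAlgebra.ι ℝ v ∈ ⋀[ℝ]^1 V := by
    rw [ExteriorAlgebra.exteriorPower, pow_one]; exact LinearMap.mem_range_self _ v
  rw [Gr.gen, Gr.comp_tmul, GradedAlgebra.proj_apply]
  split_ifs with h
  · subst h
    rw [DirectSum.decompose_of_mem_same (fun i : ℕ => ⋀[ℝ]^i V) hv]
  · rw [DirectSum.decompose_of_mem_ne (fun i : ℕ => ⋀[ℝ]^i V) hv (Ne.symm h), TensorProduct.tmul_zero]

theorem Gr.map_zero_apply (x : Gr V) :
    Gr.map (0 : V →ₗ[ℝ] W) x = algebraMap ℂ (Gr W) (Gr.body x) := by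
  have h : ExteriorAlgebra.map (0 : V →ₗ[ℝ] W) =
      (Algebra.ofId ℝ (ExteriorAlgebra ℝ W)).comp ExteriorAlgebra.algebraMapInv := by
    ext v; simp [ExteriorAlgebra.algebraMapInv]
  induction x using TensorProduct.induction_on with
  | zero => simp
  | add a b ha hb => simp only [map_add, ha, hb]
  | tmul z w =>
    rw [Gr.body_tmul, Gr.map, Algebra.TensorProduct.map_tmul, h, AlgHom.comp_apply,
      Algebra.ofId_apply, Algebra.TensorProduct.algebraMap_apply,
      Algebra.algebraMap_eq_smul_one (A := ExteriorAlgebra ℝ W),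
      TensorProduct.tmul_smul, TensorProduct.smul_tmul', Algebra.algebraMap_self, RingHom.id_apply,
      AlgHom.id_apply, mul_comm, Complex.real_smul]

/-- Multiplication by an odd generator kills all positive powers of it. -/
theorem Gr.gen_mul_map_smulRight (d : V →ₗ[ℝ] ℝ) (w : W) (x : Gr V) :
    Gr.gen w * Gr.map (d.smulRight w) x = Gr.body x • Gr.gen w := by
  induction x using TensorProduct.induction_on with
  | zero => simp
  | add a b ha hb => simp only [map_add, mul_add, add_smul, ha, hb]
  | tmul z y =>
    have h : ExteriorAlgebra.ι ℝ w * ExteriorAlgebra.map (d.smulRight w) y =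
        ExteriorAlgebra.algebraMapInv y • ExteriorAlgebra.ι ℝ w := by
      induction y using ExteriorAlgebra.induction with
      | algebraMap r => simp [Algebra.algebraMap_eq_smul_one]
      | ι u => simp [ExteriorAlgebra.algebraMapInv]
      | mul a b ha hb => rw [map_mul, ← mul_assoc, ha, smul_mul_assoc, hb, smul_smul, map_mul]
      | add a b ha hb => rw [map_add, mul_add, ha, hb, map_add, add_smul]
    rw [Gr.gen, Gr.map, Algebra.TensorProduct.map_tmul, Algebra.TensorProduct.tmul_mul_tmul, h,
      Gr.body_tmul, AlgHom.id_apply, one_mul, TensorProduct.tmul_smul, TensorProduct.smul_tmul',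
      TensorProduct.smul_tmul', Complex.real_smul, smul_eq_mul, mul_one, mul_comm]

/-- Contracting with the first and then the second dual basis vector sends the product of the two
generators to `1`, so its coefficient can be recovered. -/
theorem Gr.smul_gen_mul_gen_eq_zero {z : ℂ}
    (h : z • (Gr.gen ((1, 0) : ℝ × ℝ) * Gr.gen ((0, 1) : ℝ × ℝ)) = 0) : z = 0 := by
  let c : Module.Dual ℝ (ℝ × ℝ) → ExteriorAlgebra ℝ (ℝ × ℝ) →ₗ[ℝ] ExteriorAlgebra ℝ (ℝ × ℝ) :=
    CliffordAlgebra.contractLeft (Q := (0 : QuadraticForm ℝ (ℝ × ℝ)))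
  have hc : c (LinearMap.snd ℝ ℝ ℝ) (c (LinearMap.fst ℝ ℝ ℝ)
      (ExteriorAlgebra.ι ℝ ((1, 0) : ℝ × ℝ) * ExteriorAlgebra.ι ℝ ((0, 1) : ℝ × ℝ))) = 1 := by
    have h1 := CliffordAlgebra.contractLeft_ι_mul (Q := (0 : QuadraticForm ℝ (ℝ × ℝ)))
      (LinearMap.fst ℝ ℝ ℝ) (1, 0) (CliffordAlgebra.ι _ (0, 1))
    have h2 := CliffordAlgebra.contractLeft_ι (Q := (0 : QuadraticForm ℝ (ℝ × ℝ)))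
      (LinearMap.fst ℝ ℝ ℝ) (0, 1)
    have h3 := CliffordAlgebra.contractLeft_ι (Q := (0 : QuadraticForm ℝ (ℝ × ℝ)))
      (LinearMap.snd ℝ ℝ ℝ) (0, 1)
    rw [h2] at h1
    simp only [LinearMap.fst_apply, LinearMap.snd_apply, one_smul, map_zero, map_one, mul_zero,
      sub_zero] at h1 h3
    exact (congrArg _ h1).trans h3
  have key := congrArg (TensorProduct.map (LinearMap.id : ℂ →ₗ[ℝ] ℂ)
    (c (LinearMap.snd ℝ ℝ ℝ) ∘ₗ c (LinearMap.fst ℝ ℝ ℝ))) h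
  rw [Gr.gen, Gr.gen, Algebra.TensorProduct.tmul_mul_tmul, TensorProduct.smul_tmul',
    TensorProduct.map_tmul, LinearMap.comp_apply, hc, map_zero] at key
  have := congrArg Gr.body key
  rw [Gr.body_tmul] at this
  simpa using this

end GradedComponents

/-! ### Consequences of invariance, by specializing the odd parameters. -/

section Invariance

variable {n : ℕ} {X : Type*} [TopologicalSpace X] [ChartedSpace (Euc n) X] [IsManifold (𝓡 n) ∞ X]
  {Γ : Subgroup (Matrix.SpecialLinearGroup (Fin 2) ℤ)} {F₀ F₁ F₂ : Lat → X → Form n}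

theorem Lat.act_one_one (Λ : Lat) : Lat.act 1 1 Λ = Λ := by
  ext <;> simp [Lat.act]

theorem map_incl {U : Type*} [AddCommGroup U] [Module ℝ U]
    (φ : (Fin 3 → ℝ) × Module.Dual ℝ (Euc n) →ₗ[ℝ] U) (y : Form n) :
    Gr.map φ (incl y) = Gr.map (φ ∘ₗ LinearMap.inr ℝ _ _) y :=
  Gr.map_map _ _ y

/-- Invariance, after the specialization of the odd parameters along a linear map `φ`
which respects the relation `σ σ' = 0`. -/
theorem IsFunctionOnEps.map_actPullback {U : Type*} [AddCommGroup U] [Module ℝ U]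
    (h : IsFunctionOnEps Γ F₀ F₁ F₂)
    (φ : (Fin 3 → ℝ) × Module.Dual ℝ (Euc n) →ₗ[ℝ] U)
    (hφ : Gr.map φ σ * Gr.map φ σ' = 0) (q : ℂˣ) (u : ℂ) (Λ : Lat) (x : X) :
    Gr.map φ (actPullback F₀ F₁ F₂ 1 q u Λ x) = Gr.map φ (projPullback F₀ F₁ F₂ Λ x) := by
  obtain ⟨a, ha⟩ := Submodule.mem_span_singleton.1 (h.2.2.2 1 Γ.one_mem q u Λ x)
  rw [← sub_eq_zero, ← map_sub, ← ha, smul_eq_mul, map_mul, map_mul, hφ, mul_zero]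

theorem map_snd_incl (y : Form n) :
    Gr.map (LinearMap.snd ℝ (Fin 3 → ℝ) (Module.Dual ℝ (Euc n))) (incl y) = y := by
  rw [map_incl, LinearMap.snd_comp_inr, Gr.map_id]

/-- Setting `ν = σ = σ' = 0` makes every shift vanish, and only the rescaling of `ψ` by `q̄⁻¹`
remains. -/
theorem IsFunctionOnEps.sum_comp (h : IsFunctionOnEps Γ F₀ F₁ F₂) (q : ℂˣ) (Λ : Lat) (x : X) :
    ∑ k ∈ Finset.range (n + 1),
      (starRingEnd ℂ (q : ℂ))⁻¹ ^ k • Gr.comp k (F₀ (Lat.act 1 q Λ) x) = F₀ Λ x := by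
  have hσ : Gr.map (LinearMap.snd ℝ (Fin 3 → ℝ) (Module.Dual ℝ (Euc n))) σ = 0 := by
    simp [σ, Gr.map_gen, Gr.gen_zero]
  have hσ' : Gr.map (LinearMap.snd ℝ (Fin 3 → ℝ) (Module.Dual ℝ (Euc n))) σ' = 0 := by
    simp [σ', Gr.map_gen, Gr.gen_zero]
  have hν : Gr.map (LinearMap.snd ℝ (Fin 3 → ℝ) (Module.Dual ℝ (Euc n))) ν = 0 := by
    simp [ν, Gr.map_gen, Gr.gen_zero]
  have := h.map_actPullback (LinearMap.snd ℝ _ _) (by simp [hσ]) q 0 Λ x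
  simpa [actPullback, projPullback, shiftedValue, affineValue, hσ, hσ', hν, map_snd_incl,
    smul_pow] using this

/-- Invariance under the identity already forces this: `affineValue` only sees degrees up to `n`, so
no separate vanishing argument above degree `n` is needed. -/
theorem IsFunctionOnEps.sum_comp_self (h : IsFunctionOnEps Γ F₀ F₁ F₂) (Λ : Lat) (x : X) :
    ∑ k ∈ Finset.range (n + 1), Gr.comp k (F₀ Λ x) = F₀ Λ x := by
  simpa [Lat.act_one_one] using h.sum_comp 1 Λ x

/-- The component of degree `k` of a function on `Φ_ε(X)` scales with weight `q̄ᵏ`. -/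
theorem IsFunctionOnEps.comp_act (h : IsFunctionOnEps Γ F₀ F₁ F₂) {k : ℕ} (hk : k ≤ n) (q : ℂˣ)
    (Λ : Lat) (x : X) :
    Gr.comp k (F₀ (Lat.act 1 q Λ) x) = starRingEnd ℂ (q : ℂ) ^ k • Gr.comp k (F₀ Λ x) := by
  have hq : starRingEnd ℂ (q : ℂ) ≠ 0 := by simp
  conv_rhs => rw [← h.sum_comp q Λ x]
  simp only [map_sum, Gr.comp_smul, Gr.comp_comp]
  rw [Finset.sum_eq_single k (fun j _ hj => by simp [hj.symm]) (fun hk' => by simp at hk'; omega),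
    if_pos rfl, smul_smul, ← mul_pow, mul_inv_cancel₀ hq, one_pow, one_smul]

/-- Once forms of positive degree are set to zero, the term `e dF` disappears (its degree is `k +
1`), and so does every `k > 0`. The choice of `c` and `e` becomes irrelevant. -/
theorem map_affineValue_of_comp_inr_eq_zero {U : Type*} [AddCommGroup U] [Module ℝ U]
    {φ : (Fin 3 → ℝ) × Module.Dual ℝ (Euc n) →ₗ[ℝ] U} (hφ : φ ∘ₗ LinearMap.inr ℝ _ _ = 0)
    (c e : ParamForm n) (f : Lat → X → Form n) (Λ : Lat) (x : X) :
    Gr.map φ (affineValue c e f Λ x) = algebraMap ℂ (Gr U) (Gr.body (f Λ x)) := by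
  simp only [affineValue, map_sum, map_mul, map_add, map_pow, map_incl, hφ, Gr.map_zero_apply,
    Gr.body_comp, Nat.add_eq_zero_iff, one_ne_zero, and_false, if_false, map_zero, mul_zero,
    add_zero]
  rw [Finset.sum_eq_single 0 (fun j _ hj => by simp [hj]) (by simp)]
  simp

/-- The specialization of the odd parameters to their coefficients `a, b, c`, at which all forms of
positive degree vanish. -/
def paramMap (n : ℕ) {U : Type*} [AddCommGroup U] [Module ℝ U] (a b c : U) :
    (Fin 3 → ℝ) × Module.Dual ℝ (Euc n) →ₗ[ℝ] U :=
  (LinearMap.proj 0).smulRight a ∘ₗ LinearMap.fst ℝ _ _ +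
    (LinearMap.proj 1).smulRight b ∘ₗ LinearMap.fst ℝ _ _ +
      (LinearMap.proj 2).smulRight c ∘ₗ LinearMap.fst ℝ _ _

section paramMap

variable {U : Type*} [AddCommGroup U] [Module ℝ U] (a b c : U)

theorem map_paramMap_ν : Gr.map (paramMap n a b c) ν = Gr.gen a := by
  simp [ν, Gr.map_gen, paramMap]

theorem map_paramMap_σ : Gr.map (paramMap n a b c) σ = Gr.gen b := by
  simp [σ, Gr.map_gen, paramMap]

theorem map_paramMap_σ' : Gr.map (paramMap n a b c) σ' = Gr.gen c := by
  simp [σ', Gr.map_gen, paramMap]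

theorem paramMap_comp_inr :
    paramMap n a b c ∘ₗ LinearMap.inr ℝ (Fin 3 → ℝ) (Module.Dual ℝ (Euc n)) = 0 := by
  ext; simp [paramMap]

end paramMap

/-- This is the shape of the invariance equation with `ν = (1, 0)` and `σ` or `σ'` equal to `(0,
1)`. The term in `d` drops out because `σνσ = 0`, leaving `z b νσ = 0`. -/
theorem Gr.coeff_gen_mul_gen_eq_zero {a b c d z : ℂ} (hz : z ≠ 0)
    (h : algebraMap ℂ (Gr (ℝ × ℝ)) a +
        z • (Gr.gen (1, 0) * Gr.gen (0, 1)) * algebraMap ℂ (Gr (ℝ × ℝ)) b +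
      Gr.gen (0, 1) * (algebraMap ℂ (Gr (ℝ × ℝ)) c +
        z • (Gr.gen (1, 0) * Gr.gen (0, 1)) * algebraMap ℂ (Gr (ℝ × ℝ)) d) =
      algebraMap ℂ (Gr (ℝ × ℝ)) a + Gr.gen (0, 1) * algebraMap ℂ (Gr (ℝ × ℝ)) c) : b = 0 := by
  have h0 : Gr.gen ((0, 1) : ℝ × ℝ) * (Gr.gen (1, 0) * Gr.gen (0, 1)) = 0 := by
    have := congrArg (Gr.gen ((0, 1) : ℝ × ℝ) * ·) (Gr.gen_mul_gen_add_swap (1, 0) (0, 1))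
    rwa [mul_add (Gr.gen _), ← mul_assoc _ (Gr.gen (0, 1)) (Gr.gen (1, 0)), Gr.gen_mul_gen_self, zero_mul,
      add_zero, mul_zero] at this
  rw [mul_add, ← mul_assoc, mul_smul_comm, h0, smul_zero, zero_mul, add_zero, add_left_inj,
    add_eq_left, ← Algebra.commutes, ← Algebra.smul_def, smul_smul] at h
  exact (mul_eq_zero.1 (Gr.smul_gen_mul_gen_eq_zero h)).resolve_right hz

/-- For `q = 1`, `u = 0`, `σ' = 0` and no forms, the action only replaces `ℓ̄` by `ℓ̄ + 2iνσ`; the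
coefficient of `νσ` is `2i` times the body of `∂F₀/∂ℓ̄`. -/
theorem IsFunctionOnEps.body_dbar (h : IsFunctionOnEps Γ F₀ F₁ F₂) (Λ : Lat) (x : X) :
    Gr.body (dbar F₀ Λ x) = 0 := by
  have := h.map_actPullback (paramMap n ((1, 0) : ℝ × ℝ) (0, 1) 0)
    (by simp [map_paramMap_σ', Gr.gen_zero]) 1 0 Λ x
  simp only [actPullback, projPullback, shiftedValue, map_add, map_mul, map_smul,
    map_affineValue_of_comp_inr_eq_zero (paramMap_comp_inr _ _ _), map_paramMap_ν, map_paramMap_σ,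
    map_paramMap_σ', Gr.gen_zero, Lat.act_one_one, map_incl, paramMap_comp_inr,
    Gr.map_zero_apply] at this
  simp [-Algebra.TensorProduct.algebraMap_apply] at this
  exact Gr.coeff_gen_mul_gen_eq_zero (by simp) this

theorem IsFunctionOnEps.body_dbar' (h : IsFunctionOnEps Γ F₀ F₁ F₂) (Λ : Lat) (x : X) :
    Gr.body (dbar' F₀ Λ x) = 0 := by
  have := h.map_actPullback (paramMap n ((1, 0) : ℝ × ℝ) 0 (0, 1))
    (by simp [map_paramMap_σ, Gr.gen_zero]) 1 0 Λ x
  simp only [actPullback, projPullback, shiftedValue, map_add, map_mul, map_smul,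
    map_affineValue_of_comp_inr_eq_zero (paramMap_comp_inr _ _ _), map_paramMap_ν, map_paramMap_σ,
    map_paramMap_σ', Gr.gen_zero, Lat.act_one_one, map_incl, paramMap_comp_inr,
    Gr.map_zero_apply] at this
  simp [-Algebra.TensorProduct.algebraMap_apply] at this
  exact Gr.coeff_gen_mul_gen_eq_zero (by simp) this

/-- At `σ = σ' = 0` the odd translation gives `ν dF₀ = 0`. Sending each covector to its value on the
`i`-th basis vector, times one odd generator, isolates the coefficient of `ν dzⁱ`. -/
theorem IsFunctionOnEps.body_deriv (h : IsFunctionOnEps Γ F₀ F₁ F₂) (Λ : Lat) (x : X)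
    (i : Fin n) :
    Gr.body (Gr.deriv (fun z => inChart F₀ x (Λ.1, z)) (extChartAt (𝓡 n) x x)
      (EuclideanSpace.single i 1)) = 0 := by
  let d : Module.Dual ℝ (Euc n) →ₗ[ℝ] ℝ := LinearMap.applyₗ (EuclideanSpace.single i 1)
  let φ : (Fin 3 → ℝ) × Module.Dual ℝ (Euc n) →ₗ[ℝ] ℝ × ℝ :=
    paramMap n ((1, 0) : ℝ × ℝ) 0 0 + d.smulRight (0, 1) ∘ₗ LinearMap.snd ℝ _ _
  have hσ : Gr.map φ σ = 0 := by simp [φ, σ, Gr.map_gen, paramMap, Prod.mk_zero_zero, Gr.gen_zero]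
  have hσ' : Gr.map φ σ' = 0 := by simp [φ, σ', Gr.map_gen, paramMap, Prod.mk_zero_zero, Gr.gen_zero]
  have hν : Gr.map φ ν = Gr.gen (1, 0) := by simp [φ, ν, Gr.map_gen, paramMap]
  have hφ : φ ∘ₗ LinearMap.inr ℝ _ _ = d.smulRight (0, 1) := by ext <;> simp [φ, paramMap]
  -- Only `dzⁱ` survives the specialization, and its square-zero image annihilates everything but
  -- the body of the partial derivative.
  have hd : Gr.map (d.smulRight ((0, 1) : ℝ × ℝ)) (dX F₀ Λ x) =
      Gr.body (Gr.deriv (fun z => inChart F₀ x (Λ.1, z)) (extChartAt (𝓡 n) x x)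
        (EuclideanSpace.single i 1)) • Gr.gen (0, 1) := by
    simp only [dX, map_sum, map_mul, Gr.map_gen]
    rw [Finset.sum_eq_single i]
    · rw [← Gr.gen_mul_map_smulRight d]
      simp [d]
    · intro j _ hj
      simp [d, hj, Gr.gen_zero]
    · simp
  have := h.map_actPullback φ (by simp [hσ]) 1 0 Λ x
  simp only [actPullback, projPullback, shiftedValue, affineValue, map_add, map_mul, map_smul,
    map_sum, map_pow, map_neg, map_sub, hσ, hσ', hν, Lat.act_one_one, map_incl, hφ,
    ← Gr.comp_map, hd, Gr.comp_smul, Gr.comp_gen] at this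
  simp only [Gr.comp_map, mul_add, Finset.sum_add_distrib] at this
  simp [-Algebra.TensorProduct.algebraMap_apply, ← map_sum, h.sum_comp_self] at this
  have hneg : ∀ {R : Type} [Ring R] (a b : R), -a * b = 0 → a * b = 0 := fun a b h => by
    rwa [neg_mul, neg_eq_zero] at h
  have h0 := hneg _ _ this
  rw [mul_smul_comm] at h0
  exact Gr.smul_gen_mul_gen_eq_zero h0

end Invariance

/-! ### From vanishing derivatives to local constancy and holomorphy. -/

section Calculus

/-- The body is real linear, so it commutes with differentiation in coordinates. -/
theorem Gr.body_deriv {V : Type*} [AddCommGroup V] [Module ℝ V] [Module.Finite ℝ V] {F : Type*}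
    [NormedAddCommGroup F] [NormedSpace ℝ F] {f : F → Gr V} {z : F}
    (hf : ∀ c : Gr V →ₗ[ℝ] ℝ, DifferentiableAt ℝ (fun y => c (f y)) z) :
    DifferentiableAt ℝ (fun y => Gr.body (f y)) z ∧
      ∀ v, Gr.body (Gr.deriv f z v) = fderiv ℝ (fun y => Gr.body (f y)) z v := by
  set b := Module.finBasis ℝ (Gr V) with hb
  have key : (fun y => Gr.body (f y)) = fun y => ∑ j, b.repr (f y) j • Gr.body (b j) := by
    funext y
    conv_lhs => rw [← b.sum_repr (f y)]
    simp only [map_sum, Complex.real_smul]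
    exact Finset.sum_congr rfl fun j _ => map_smul (Gr.body.restrictScalars ℝ) _ _
  have hd : ∀ j, HasFDerivAt (fun y => b.repr (f y) j • Gr.body (b j))
      ((fderiv ℝ (fun y => b.repr (f y) j) z).smulRight (Gr.body (b j))) z := fun j =>
    (hf (b.coord j)).hasFDerivAt.smul_const _
  have hs := HasFDerivAt.fun_sum fun j (_ : j ∈ Finset.univ) => hd j
  rw [key]
  refine ⟨hs.differentiableAt, fun v => ?_⟩
  rw [hs.fderiv, Gr.deriv, map_sum, sum_apply]
  exact Finset.sum_congr rfl fun j _ => map_smul (Gr.body.restrictScalars ℝ) _ _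

theorem isOpen_Lat : IsOpen Lat := by
  have : Lat = {p | 0 < (starRingEnd ℂ p.1 * p.2).im} := Set.ext mem_Lat_iff
  rw [this]
  refine isOpen_lt continuous_const ?_
  exact Complex.continuous_im.comp
    ((Complex.continuous_conj.comp continuous_fst).mul continuous_snd)

/-- `Lat` is the image of the product of the punctured plane and the upper half plane under `(ℓ, τ)
↦ (ℓ, ℓτ)`. -/
theorem isPreconnected_Lat : IsPreconnected Lat := by
  have h1 : IsPreconnected ({0}ᶜ : Set ℂ) :=
    (isConnected_compl_singleton_of_one_lt_rank (by simp [Complex.rank_real_complex]) 0).isPreconnected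
  have h2 : IsPreconnected {z : ℂ | 0 < z.im} := (convex_halfSpace_im_gt 0).isPreconnected
  have h := (h1.prod h2).image (fun p => (p.1, p.1 * p.2))
    (continuous_fst.prodMk (continuous_fst.mul continuous_snd)).continuousOn
  convert h using 1
  ext ⟨a, b⟩
  constructor
  · intro hp
    have ha : a ≠ 0 := by rintro rfl; simp [Lat] at hp
    exact ⟨(a, b / a), ⟨ha, hp⟩, by simp [mul_div_cancel₀, ha]⟩
  · rintro ⟨⟨c, t⟩, ⟨hc, ht⟩, h⟩
    simp only [Prod.mk.injEq] at h
    obtain ⟨rfl, rfl⟩ := h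
    have hc' : c ≠ 0 := hc
    simpa [Lat, hc'] using ht

variable {n : ℕ} {X : Type*} [TopologicalSpace X] [ChartedSpace (Euc n) X] [IsManifold (𝓡 n) ∞ X]

/-- A function whose differential vanishes at the centre of every preferred chart is locally
constant. -/
theorem isLocallyConstant_of_fderiv_extChartAt_symm_eq_zero {g : X → ℂ}
    (hg : ∀ x, DifferentiableOn ℝ (g ∘ (extChartAt (𝓡 n) x).symm) (extChartAt (𝓡 n) x).target)
    (h0 : ∀ x, fderiv ℝ (g ∘ (extChartAt (𝓡 n) x).symm) (extChartAt (𝓡 n) x x) = 0) :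
    IsLocallyConstant g := by
  have hz : ∀ x, ∀ z ∈ (extChartAt (𝓡 n) x).target,
      fderiv ℝ (g ∘ (extChartAt (𝓡 n) x).symm) z = 0 := by
    intro x z hz
    -- The hypothesis speaks only of chart centres, so pass to the chart centred at `y` and apply
    -- the chain rule to the transition map.
    set y := (extChartAt (𝓡 n) x).symm z with hy
    have hyx : y ∈ (extChartAt (𝓡 n) x).source := (extChartAt (𝓡 n) x).map_target hz
    have hxz : extChartAt (𝓡 n) x y = z := (extChartAt (𝓡 n) x).right_inv hz
    have h1 := hasFDerivWithinAt_tangentCoordChange (I := 𝓡 n) (x := x) (y := y) (z := y)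
      ⟨hyx, mem_extChartAt_source y⟩
    rw [ModelWithCorners.range_eq_univ, hasFDerivWithinAt_univ, hxz] at h1
    have h2 : HasFDerivAt (g ∘ (extChartAt (𝓡 n) y).symm) (0 : Euc n →L[ℝ] ℂ)
        ((extChartAt (𝓡 n) y ∘ (extChartAt (𝓡 n) x).symm) z) := by
      have := ((hg y).differentiableAt (extChartAt_target_mem_nhds y)).hasFDerivAt
      rwa [h0 y] at this
    have h3 := h2.comp z h1
    rw [ContinuousLinearMap.zero_comp] at h3
    refine (h3.congr_of_eventuallyEq ?_).fderiv
    have hc : ContinuousAt (extChartAt (𝓡 n) x).symm z := continuousAt_extChartAt_symm'' hz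
    filter_upwards [hc.preimage_mem_nhds (extChartAt_source_mem_nhds (I := 𝓡 n) y)] with w hw
    simp only [Function.comp_apply]
    rw [(extChartAt (𝓡 n) y).left_inv hw]
  refine (IsLocallyConstant.iff_eventually_eq g).2 fun x => ?_
  obtain ⟨ε, hε, hball⟩ := Metric.mem_nhds_iff.1 (extChartAt_target_mem_nhds (I := 𝓡 n) x)
  filter_upwards [extChartAt_source_mem_nhds (I := 𝓡 n) x,
    (continuousAt_extChartAt (I := 𝓡 n) x).preimage_mem_nhds (Metric.ball_mem_nhds _ hε)]
    with y hy hy'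
  have := Metric.isOpen_ball.is_const_of_fderiv_eq_zero (convex_ball _ _).isPreconnected
    ((hg x).mono hball) (fun z h => hz x z (hball h)) hy' (Metric.mem_ball_self hε)
  rwa [Function.comp_apply, Function.comp_apply, (extChartAt (𝓡 n) x).left_inv hy,
    extChartAt_to_inv] at this

theorem inChart_coe (f : Lat → X → Form n) (x₀ : X) (Λ : Lat) (z : Euc n) :
    inChart f x₀ (Λ, z) =
      Gr.map ((tangentCoordChange (𝓡 n) x₀ ((extChartAt (𝓡 n) x₀).symm z)
        ((extChartAt (𝓡 n) x₀).symm z)).toLinearMap.dualMap)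
          (f Λ ((extChartAt (𝓡 n) x₀).symm z)) := by
  simp only [inChart]
  rw [Subtype.val_injective.extend_apply]

/-- At the centre of its own chart the coordinate change is the identity. This turns smoothness in
charts into smoothness in the lattice at fixed `x`. -/
theorem inChart_extChartAt_self (f : Lat → X → Form n) (x : X) (p : ℂ × ℂ) :
    inChart f x (p, extChartAt (𝓡 n) x x) =
      Function.extend (Subtype.val : Lat → ℂ × ℂ) (fun Λ => f Λ x) 0 p := by
  have h : (tangentCoordChange (𝓡 n) x x x).toLinearMap.dualMap = LinearMap.id := by
    ext φ v
    simp only [LinearMap.dualMap_apply, LinearMap.id_apply]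
    exact congrArg φ (tangentCoordChange_self (mem_extChartAt_source x))
  simp only [inChart, extChartAt_to_inv]
  rw [h, Gr.map_id]

theorem IsSmooth.differentiableAt {f : Lat → X → Form n} (hf : IsSmooth f) (x₀ : X)
    {p : (ℂ × ℂ) × Euc n} (hp : p ∈ Lat ×ˢ (extChartAt (𝓡 n) x₀).target)
    (c : Form n →ₗ[ℝ] ℝ) : DifferentiableAt ℝ (fun p => c (inChart f x₀ p)) p :=
  ((hf x₀ c).differentiableOn (by simp)).differentiableAt
    ((isOpen_Lat.prod (isOpen_extChartAt_target x₀)).mem_nhds hp)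

theorem isLocallyConstant_body {f : Lat → X → Form n} (hf : IsSmooth f) (Λ : Lat)
    (h : ∀ x i, Gr.body (Gr.deriv (fun z => inChart f x (Λ.1, z)) (extChartAt (𝓡 n) x x)
      (EuclideanSpace.single i 1)) = 0) : IsLocallyConstant fun x => Gr.body (f Λ x) := by
  -- The coordinate change acts on covectors and leaves the body alone.
  have e : ∀ x, (fun x => Gr.body (f Λ x)) ∘ (extChartAt (𝓡 n) x).symm =
      fun z => Gr.body (inChart f x (Λ.1, z)) := fun x => by
    funext z
    rw [inChart_coe, Gr.body_map, Function.comp_apply]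
  have hd : ∀ x, ∀ z ∈ (extChartAt (𝓡 n) x).target, ∀ c : Form n →ₗ[ℝ] ℝ,
      DifferentiableAt ℝ (fun z => c (inChart f x (Λ.1, z))) z := fun x z hz c =>
    DifferentiableAt.comp (f := fun z => (Λ.1, z)) z (hf.differentiableAt x (p := (Λ.1, z)) ⟨Λ.2, hz⟩ c)
      ((differentiableAt_const _).prodMk differentiableAt_id)
  refine isLocallyConstant_of_fderiv_extChartAt_symm_eq_zero (n := n) (fun x z hz => ?_)
    fun x => ?_
  · rw [e]
    exact (Gr.body_deriv (hd x z hz)).1.differentiableWithinAt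
  · rw [e]
    have := (Gr.body_deriv (hd x _ (mem_extChartAt_target x))).2
    refine ContinuousLinearMap.coe_injective ((EuclideanSpace.basisFun (Fin n) ℝ).toBasis.ext
      fun i => ?_)
    have hi := (this (EuclideanSpace.single i 1)).symm
    rw [h] at hi
    simpa using hi

/-- The hypotheses are the Cauchy–Riemann equations in `ℓ` and `ℓ'`: they make the real differential
complex linear. -/
theorem differentiableOn_body_extend {f : Lat → X → Form n} (hf : IsSmooth f) (x : X)
    (h : ∀ Λ, Gr.body (dbar f Λ x) = 0) (h' : ∀ Λ, Gr.body (dbar' f Λ x) = 0) :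
    DifferentiableOn ℂ (fun p => Gr.body
      (Function.extend (Subtype.val : Lat → ℂ × ℂ) (fun Λ => f Λ x) 0 p)) Lat := by
  intro p hp
  have hd : ∀ c : Form n →ₗ[ℝ] ℝ, DifferentiableAt ℝ (fun p => c
      (Function.extend (Subtype.val : Lat → ℂ × ℂ) (fun Λ => f Λ x) 0 p)) p := fun c => by
    simp only [← inChart_extChartAt_self]
    exact DifferentiableAt.comp (f := fun p => (p, extChartAt (𝓡 n) x x)) p
      (hf.differentiableAt x ⟨hp, mem_extChartAt_target x⟩ c)
      (differentiableAt_id.prodMk (differentiableAt_const _))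
  obtain ⟨h1, h2⟩ := Gr.body_deriv hd
  refine DifferentiableAt.differentiableWithinAt ?_
  rw [differentiableAt_iff_restrictScalars ℝ h1]
  set D := fderiv ℝ (fun p => Gr.body
    (Function.extend (Subtype.val : Lat → ℂ × ℂ) (fun Λ => f Λ x) 0 p)) p
  have e1 : D (Complex.I, 0) = Complex.I * D (1, 0) := by
    have := h ⟨p, hp⟩
    simp only [dbar, dLat, map_smul, map_add, h2, smul_eq_mul] at this
    linear_combination (-2 * Complex.I) * this + D (Complex.I, 0) * Complex.I_sq
  have e2 : D (0, Complex.I) = Complex.I * D (0, 1) := by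
    have := h' ⟨p, hp⟩
    simp only [dbar', dLat, map_smul, map_add, h2, smul_eq_mul] at this
    linear_combination (-2 * Complex.I) * this + D (0, Complex.I) * Complex.I_sq
  refine ⟨(ContinuousLinearMap.fst ℂ ℂ ℂ).smulRight (D (1, 0)) +
    (ContinuousLinearMap.snd ℂ ℂ ℂ).smulRight (D (0, 1)), ?_⟩
  refine ContinuousLinearMap.ext fun ⟨a, b⟩ => ?_
  have hab : (a, b) = a.re • ((1, 0) : ℂ × ℂ) + a.im • ((Complex.I, 0) : ℂ × ℂ) +
      (b.re • ((0, 1) : ℂ × ℂ) + b.im • ((0, Complex.I) : ℂ × ℂ)) := by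
    ext <;> simp
  rw [hab, map_add D, map_add D, map_add D, map_smul D, map_smul D, map_smul D, map_smul D, e1, e2,
    ← hab]
  simp
  linear_combination -D (1, 0) * Complex.re_add_im a - D (0, 1) * Complex.re_add_im b

end Calculus

/-! ### Weights of dilations, rigidity of holomorphic functions, and uniqueness of the phase. -/

section Rigidity

theorem exists_conj_pow_eq_I {k : ℕ} (hk : 0 < k) :
    ∃ q : ℂˣ, starRingEnd ℂ (q : ℂ) ^ k = Complex.I := by
  obtain ⟨z, hz⟩ := IsAlgClosed.exists_pow_nat_eq (-Complex.I) hk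
  have hz0 : z ≠ 0 := by
    rintro rfl
    rw [zero_pow hk.ne'] at hz
    exact Complex.I_ne_zero (neg_eq_zero.1 hz.symm)
  refine ⟨Units.mk0 z hz0, ?_⟩
  rw [Units.val_mk0, ← map_pow, hz]
  simp

/-- The character `q ↦ q̄ⁱ qʲ`. -/
def conjPowMulPow (p : ℕ × ℕ) : ℂˣ →* ℂ where
  toFun q := starRingEnd ℂ (q : ℂ) ^ p.1 * (q : ℂ) ^ p.2
  map_one' := by simp
  map_mul' a b := by simp [mul_pow]; ring

theorem conjPowMulPow_le {i j i' j' : ℕ} (h : conjPowMulPow (i, j) = conjPowMulPow (i', j'))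
    (hs : i + j = i' + j') : i ≤ i' := by
  by_contra! hlt
  obtain ⟨d, hd, rfl⟩ : ∃ d, 0 < d ∧ i = i' + d := ⟨i - i', by omega, by omega⟩
  obtain rfl : j' = j + d := by omega
  -- Equality of the characters would force `q̄ᵈ = qᵈ`, but here these are `i` and `-i`.
  obtain ⟨q, hq⟩ := exists_conj_pow_eq_I hd
  have hq' : (q : ℂ) ^ d = -Complex.I := by
    have := congrArg (starRingEnd ℂ) hq
    simpa using this
  have h1 : starRingEnd ℂ (q : ℂ) ^ (i' + d) * (q : ℂ) ^ j =
    starRingEnd ℂ (q : ℂ) ^ i' * (q : ℂ) ^ (j + d) := DFunLike.congr_fun h q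
  have h0 : starRingEnd ℂ (q : ℂ) ^ i' * (q : ℂ) ^ j ≠ 0 := by simp
  rw [pow_add, pow_add, hq, hq'] at h1
  have h2 : starRingEnd ℂ (q : ℂ) ^ i' * (q : ℂ) ^ j * (2 * Complex.I) = 0 := by
    linear_combination h1
  simp at h2

theorem conjPowMulPow_injective : Function.Injective conjPowMulPow := by
  rintro ⟨i, j⟩ ⟨i', j'⟩ h
  have hs : i + j = i' + j' := by
    -- Evaluation at the real number `q = 2` detects the total exponent `i + j`.
    have h2 : starRingEnd ℂ (2 : ℂ) ^ i * (2 : ℂ) ^ j = starRingEnd ℂ (2 : ℂ) ^ i' * (2 : ℂ) ^ j' :=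
      DFunLike.congr_fun h (Units.mk0 2 two_ne_zero)
    rw [Complex.conj_ofNat, ← pow_add, ← pow_add] at h2
    exact Nat.pow_right_injective le_rfl (by exact_mod_cast h2)
  have h1 := conjPowMulPow_le h hs
  have h2 := conjPowMulPow_le h.symm hs.symm
  ext <;> simp <;> omega

/-- Dedekind's independence of characters, applied after each linear functional on `E`. -/
theorem eq_zero_of_sum_conjPowMulPow_smul_eq_zero {E : Type*} [AddCommGroup E] [Module ℂ E]
    (s : Finset (ℕ × ℕ)) (D : ℕ × ℕ → E) (h : ∀ q, ∑ p ∈ s, conjPowMulPow p q • D p = 0)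
    {p : ℕ × ℕ} (hp : p ∈ s) : D p = 0 := by
  rw [← Module.forall_dual_apply_eq_zero_iff ℂ]
  intro φ
  have hli := (linearIndependent_monoidHom ℂˣ ℂ).comp _ conjPowMulPow_injective
  refine linearIndependent_iff'.1 hli s (fun p => φ (D p)) (funext fun q => ?_) p hp
  have := congrArg φ (h q)
  rw [map_sum, map_zero] at this
  simpa [mul_comm] using this

variable {n : ℕ} {X : Type*} [TopologicalSpace X] [ChartedSpace (Euc n) X] [IsManifold (𝓡 n) ∞ X]
  {Γ : Subgroup (Matrix.SpecialLinearGroup (Fin 2) ℤ)}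

/-- The degree zero part of a function on `Φ_ε(X)` is locally constant along `X` and holomorphic
on the space of lattices. -/
theorem IsFunctionOnEps.exists_differentiableOn [ConnectedSpace X] {F₀ F₁ F₂ : Lat → X → Form n}
    (h : IsFunctionOnEps Γ F₀ F₁ F₂) :
    ∃ G : ℂ × ℂ → ℂ, DifferentiableOn ℂ G Lat ∧ ∀ Λ x, Gr.body (F₀ Λ x) = G Λ.1 := by
  obtain ⟨x₀⟩ : Nonempty X := inferInstance
  refine ⟨_, differentiableOn_body_extend h.1 x₀ (fun Λ => h.body_dbar Λ x₀)
    (fun Λ => h.body_dbar' Λ x₀), fun Λ x => ?_⟩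
  have := (isLocallyConstant_body h.1 Λ fun x i => h.body_deriv Λ x i).apply_eq_of_preconnectedSpace
    x x₀
  simpa [Subtype.val_injective.extend_apply] using this

theorem _root_.DifferentiableOn.div_of_ne_zero {E : Type*} [NormedAddCommGroup E] [NormedSpace ℂ E]
    {F G : E → ℂ} {s : Set E} (hG : DifferentiableOn ℂ G s) (hF : DifferentiableOn ℂ F s)
    (h0 : ∀ p ∈ s, F p ≠ 0) : DifferentiableOn ℂ (fun p => G p / F p) s := by
  simp only [div_eq_mul_inv]
  exact hG.mul (hF.inv h0)

/-- The modulus attains its maximum at the square lattice `(1, i)`, so the maximum principle applies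
on the connected open set `Lat`. -/
theorem exists_eq_of_norm_eq_one {G : ℂ × ℂ → ℂ} (hG : DifferentiableOn ℂ G Lat)
    (h1 : ∀ p ∈ Lat, ‖G p‖ = 1) : ∃ c : ℂ, ‖c‖ = 1 ∧ ∀ p ∈ Lat, G p = c := by
  have h0 : ((1, Complex.I) : ℂ × ℂ) ∈ Lat := by simp [Lat]
  refine ⟨G (1, Complex.I), h1 _ h0, fun p hp => ?_⟩
  exact Complex.eqOn_of_isPreconnected_of_isMaxOn_norm isPreconnected_Lat isOpen_Lat hG h0
    (fun q hq => by simp [h1 q hq, h1 _ h0]) hp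

/-- The Cayley transform `(G - i) / (G + i)` of a real-valued `G` has modulus one, hence is
constant, and it is injective in the value of `G`. -/
theorem exists_eq_of_real {G : ℂ × ℂ → ℂ} (hG : DifferentiableOn ℂ G Lat)
    (hr : ∀ p ∈ Lat, starRingEnd ℂ (G p) = G p) : ∃ r : ℝ, ∀ p ∈ Lat, G p = r := by
  have hne : ∀ p ∈ Lat, G p + Complex.I ≠ 0 := fun p hp h => by
    have h' := congrArg (starRingEnd ℂ) h
    rw [map_add, hr p hp, Complex.conj_I, map_zero] at h'
    have : 2 * Complex.I = 0 := by linear_combination h - h'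
    simp at this
  obtain ⟨c, -, hc⟩ := exists_eq_of_norm_eq_one
    (hG.sub_const Complex.I |>.div_of_ne_zero (hG.add_const Complex.I) hne) fun p hp => by
      have : G p - Complex.I = starRingEnd ℂ (G p + Complex.I) := by
        rw [map_add, hr p hp, Complex.conj_I, sub_eq_add_neg]
      rw [norm_div, this, Complex.norm_conj, div_self (norm_ne_zero_iff.2 (hne p hp))]
  have h0 : ((1, Complex.I) : ℂ × ℂ) ∈ Lat := by simp [Lat]
  refine ⟨(G (1, Complex.I)).re, fun p hp => ?_⟩
  rw [Complex.conj_eq_iff_re.1 (hr _ h0)]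
  have h := (hc p hp).trans (hc _ h0).symm
  rw [div_eq_div_iff (hne p hp) (hne _ h0)] at h
  have : 2 * Complex.I * (G p - G (1, Complex.I)) = 0 := by linear_combination h
  simpa [sub_eq_zero] using this

/-- A real function on `Φ_ε(X)` restricts to a function of degree zero. -/
theorem IsFunctionOnEps.eq_body_of_conj_eq {F₀ F₁ F₂ : Lat → X → Form n}
    (h : IsFunctionOnEps Γ F₀ F₁ F₂) (hr : ∀ Λ x, Gr.conj (F₀ Λ x) = F₀ Λ x) (Λ : Lat) (x : X) :
    F₀ Λ x = algebraMap ℂ (Form n) (Gr.body (F₀ Λ x)) := by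
  conv_lhs => rw [← h.sum_comp_self Λ x]
  rw [← Gr.comp_zero]
  refine Finset.sum_eq_single_of_mem 0 (by simp) fun k hk hk0 => ?_
  -- For this `q` the component at the dilated lattice is `i` times the one at `Λ`. Both are real,
  -- so conjugation shows that it is also `-i` times it.
  obtain ⟨q, hq⟩ := exists_conj_pow_eq_I (Nat.pos_of_ne_zero hk0)
  have h1 := h.comp_act (Nat.lt_succ_iff.1 (Finset.mem_range.1 hk)) q Λ x
  rw [hq] at h1
  have h2 := congrArg Gr.conj h1
  rw [← Gr.comp_conj, hr, Gr.conj_smul, ← Gr.comp_conj, hr, h1, Complex.conj_I] at h2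
  have h3 : (2 * Complex.I) • Gr.comp k (F₀ Λ x) = 0 := by
    rw [two_mul, add_smul]
    nth_rw 1 [h2]
    rw [← add_smul, neg_add_cancel, zero_smul]
  exact (smul_eq_zero.1 h3).resolve_left (by simp)

theorem IsFunctionOnEps.mul_conj_act {F₀ F₁ F₂ : Lat → X → Form n}
    (h : IsFunctionOnEps Γ F₀ F₁ F₂) (q : ℂˣ) (Λ : Lat) (x : X) :
    F₀ (Lat.act 1 q Λ) x * Gr.conj (F₀ (Lat.act 1 q Λ) x) =
      ∑ p ∈ Finset.range (n + 1) ×ˢ Finset.range (n + 1), conjPowMulPow p q •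
        (Gr.comp p.1 (F₀ Λ x) * Gr.conj (Gr.comp p.2 (F₀ Λ x))) := by
  conv_lhs => rw [← h.sum_comp_self (Lat.act 1 q Λ) x]
  rw [map_sum, Finset.sum_mul_sum, ← Finset.sum_product']
  refine Finset.sum_congr rfl fun p hp => ?_
  rw [Finset.mem_product, Finset.mem_range, Finset.mem_range] at hp
  rw [h.comp_act (by omega), h.comp_act (by omega), Gr.conj_smul, smul_mul_smul_comm]
  simp [conjPowMulPow]

/-- Evaluating the single identity `heq` at all dilates of `Λ` separates it by weight `q̄ⁱ qʲ`.
Exterior degree alone would only give the sums over `i + j` fixed. -/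
theorem IsFunctionOnEps.comp_mul_conj_comp {F₀ F₁ F₂ G₀ G₁ G₂ : Lat → X → Form n}
    (h : IsFunctionOnEps Γ F₀ F₁ F₂) (h' : IsFunctionOnEps Γ G₀ G₁ G₂)
    (heq : ∀ Λ x, F₀ Λ x * Gr.conj (F₀ Λ x) = G₀ Λ x * Gr.conj (G₀ Λ x))
    {i j : ℕ} (hi : i ≤ n) (hj : j ≤ n) (Λ : Lat) (x : X) :
    Gr.comp i (F₀ Λ x) * Gr.conj (Gr.comp j (F₀ Λ x)) =
      Gr.comp i (G₀ Λ x) * Gr.conj (Gr.comp j (G₀ Λ x)) := by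
  refine sub_eq_zero.1 (eq_zero_of_sum_conjPowMulPow_smul_eq_zero
    (Finset.range (n + 1) ×ˢ Finset.range (n + 1))
    (fun p => Gr.comp p.1 (F₀ Λ x) * Gr.conj (Gr.comp p.2 (F₀ Λ x)) -
      Gr.comp p.1 (G₀ Λ x) * Gr.conj (Gr.comp p.2 (G₀ Λ x))) (fun q => ?_) (p := (i, j))
      (by simp; omega))
  simp only [smul_sub, Finset.sum_sub_distrib]
  rw [← h.mul_conj_act, ← h'.mul_conj_act, heq, sub_self]

/-- Case `j = 0` of `comp_mul_conj_comp`, where the conjugated factor is a scalar, summed over `i`.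
-/
theorem IsFunctionOnEps.body_smul_eq {F₀ F₁ F₂ G₀ G₁ G₂ : Lat → X → Form n}
    (h : IsFunctionOnEps Γ F₀ F₁ F₂) (h' : IsFunctionOnEps Γ G₀ G₁ G₂)
    (heq : ∀ Λ x, F₀ Λ x * Gr.conj (F₀ Λ x) = G₀ Λ x * Gr.conj (G₀ Λ x)) (Λ : Lat) (x : X) :
    starRingEnd ℂ (Gr.body (F₀ Λ x)) • F₀ Λ x = starRingEnd ℂ (Gr.body (G₀ Λ x)) • G₀ Λ x := by
  have key : ∀ y : Form n, Gr.conj (Gr.comp 0 y) = algebraMap ℂ _ (starRingEnd ℂ (Gr.body y)) :=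
    fun y => by rw [← Gr.comp_conj, Gr.comp_zero, Gr.body_conj]
  conv_lhs => rw [← h.sum_comp_self Λ x, Finset.smul_sum]
  conv_rhs => rw [← h'.sum_comp_self Λ x, Finset.smul_sum]
  have hb : ∀ {F₀ F₁ F₂ : Lat → X → Form n}, IsFunctionOnEps Γ F₀ F₁ F₂ →
      Gr.body (∑ k ∈ Finset.range (n + 1), Gr.comp k (F₀ Λ x)) = Gr.body (F₀ Λ x) :=
    fun h => by rw [h.sum_comp_self]
  rw [hb h, hb h']
  refine Finset.sum_congr rfl fun k hk => ?_
  have := h.comp_mul_conj_comp h' heq (Nat.lt_succ_iff.1 (Finset.mem_range.1 hk)) n.zero_le Λ x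
  rwa [key, key, ← Algebra.commutes, ← Algebra.commutes, ← Algebra.smul_def,
    ← Algebra.smul_def] at this

/-- The quotient of the bodies is holomorphic of modulus one, hence a constant `c`; `body_smul_eq`
carries this phase over to the positive degrees. -/
theorem IsFunctionOnEps.exists_phase [ConnectedSpace X] {F₀ F₁ F₂ G₀ G₁ G₂ : Lat → X → Form n}
    (h : IsFunctionOnEps Γ F₀ F₁ F₂) (h' : IsFunctionOnEps Γ G₀ G₁ G₂)
    (heq : ∀ Λ x, F₀ Λ x * Gr.conj (F₀ Λ x) = G₀ Λ x * Gr.conj (G₀ Λ x))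
    (hne : ∀ Λ x, Gr.body (F₀ Λ x) ≠ 0) :
    ∃ c : ℂ, ‖c‖ = 1 ∧ ∀ Λ x, G₀ Λ x = c • F₀ Λ x := by
  obtain ⟨x₀⟩ : Nonempty X := inferInstance
  have hnorm : ∀ Λ x, ‖Gr.body (F₀ Λ x)‖ = ‖Gr.body (G₀ Λ x)‖ := fun Λ x => by
    have := congrArg Gr.body (heq Λ x)
    rw [map_mul, map_mul, Gr.body_conj, Gr.body_conj, Complex.mul_conj, Complex.mul_conj,
      Complex.ofReal_inj, Complex.normSq_eq_norm_sq, Complex.normSq_eq_norm_sq] at this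
    exact (sq_eq_sq₀ (norm_nonneg _) (norm_nonneg _)).1 this
  obtain ⟨F, hF, hF'⟩ := h.exists_differentiableOn
  obtain ⟨G, hG, hG'⟩ := h'.exists_differentiableOn
  have hF0 : ∀ p ∈ Lat, F p ≠ 0 := fun p hp => by
    rw [← hF' ⟨p, hp⟩ x₀]; exact hne _ _
  obtain ⟨c, hc1, hc⟩ := exists_eq_of_norm_eq_one (hG.div_of_ne_zero hF hF0) fun p hp => by
    rw [norm_div, ← hF' ⟨p, hp⟩ x₀, ← hG' ⟨p, hp⟩ x₀, ← hnorm,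
      div_self (norm_ne_zero_iff.2 (hne _ _))]
  refine ⟨c, hc1, fun Λ x => ?_⟩
  have hΛ : Gr.body (G₀ Λ x) = c * Gr.body (F₀ Λ x) := by
    rw [hF', hG', ← hc _ Λ.2, div_mul_cancel₀ _ (hF0 _ Λ.2)]
  have hG0 : starRingEnd ℂ (Gr.body (G₀ Λ x)) ≠ 0 := by
    rw [map_ne_zero, ← norm_ne_zero_iff, ← hnorm]
    exact norm_ne_zero_iff.2 (hne _ _)
  have hcc : starRingEnd ℂ c * c = 1 := by
    rw [mul_comm, Complex.mul_conj, Complex.normSq_eq_norm_sq, hc1]; simp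
  -- After multiplying by the nonzero conjugate body of `G₀`, both sides equal the conjugate body of
  -- `F₀` times `F₀`, because `c̄ c = 1`.
  refine smul_right_injective _ hG0 ?_
  show starRingEnd ℂ (Gr.body (G₀ Λ x)) • G₀ Λ x = starRingEnd ℂ (Gr.body (G₀ Λ x)) • c • F₀ Λ x
  rw [← h.body_smul_eq h' heq, smul_smul, hΛ, map_mul]
  congr 1
  linear_combination (-starRingEnd ℂ (Gr.body (F₀ Λ x))) * hcc

theorem EvenFun.conj_mul (f g : EvenFun n X) :
    EvenFun.conj (f * g) = EvenFun.conj f * EvenFun.conj g :=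
  Subtype.ext (funext fun Λ => funext fun x => map_mul Gr.conj (f.1 Λ x) (g.1 Λ x))

theorem MetrizedLineBundle.inner_smul_smul (𝓛 : MetrizedLineBundle n X) (f : EvenFun n X)
    (e : 𝓛.E) :
    𝓛.inner (f • e) (f • e) = f * EvenFun.conj f * 𝓛.inner e e := by
  rw [𝓛.inner_smul_left, 𝓛.inner_conj (f • e) e, 𝓛.inner_smul_left, EvenFun.conj_mul,
    ← 𝓛.inner_conj, mul_assoc]

end Rigidity

end ClassicalVacua

end

/-! ### The main theorem. -/

theorem mainTheorem9 (n : ℕ) (X : Type*) [TopologicalSpace X] [T2Space X]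
    [SecondCountableTopology X] [ConnectedSpace X]
    [ChartedSpace (ClassicalVacua.Euc n) X] [IsManifold (𝓡 n) ∞ X]
    (Γ : Subgroup (Matrix.SpecialLinearGroup (Fin 2) ℤ)) (hΓ : Γ = ⊤ ∨ Γ = ⊥) :
    (∀ (𝓛 : ClassicalVacua.VacuaLineBundle n X Γ) (s t : 𝓛.E),
      𝓛.IsSusyTrivialization s → 𝓛.IsSusyTrivialization t →
        ∃ c : ℂ, ‖c‖ = 1 ∧ t = algebraMap ℂ (ClassicalVacua.EvenFun n X) c • s) ∧
    (∀ f : ClassicalVacua.Lat → X → ClassicalVacua.Form n, ClassicalVacua.IsSusy Γ f →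
      (∀ Λ x, ClassicalVacua.Gr.conj (f Λ x) = f Λ x) →
        ∃ r : ℝ, ∀ Λ x, f Λ x = algebraMap ℝ (ClassicalVacua.Form n) r) := by
  open ClassicalVacua in
  constructor
  · rintro 𝓛 s t ⟨⟨f, ⟨-, F₁, F₂, hf⟩, rfl⟩, hs⟩ ⟨⟨g, ⟨-, G₁, G₂, hg⟩, rfl⟩, ht⟩
    rw [MetrizedLineBundle.inner_smul_smul] at hs ht
    have heq : f * EvenFun.conj f = g * EvenFun.conj g := by
      -- Both `f f̄` and `g ḡ` are inverse to the norm squared of the preferred section.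
      linear_combination (g * EvenFun.conj g) * hs - (f * EvenFun.conj f) * ht
    -- By the unit norm condition `f` is invertible, so its value at a point of the reduced manifold
    -- is nonzero.
    have hne : ∀ Λ x, Gr.body (f.1 Λ x) ≠ 0 := fun Λ x h0 => by
      have := congrArg (EvenFun.eval Λ x) hs
      rw [map_mul, map_mul, map_one] at this
      have h0' : EvenFun.eval Λ x f = 0 := h0
      simp [h0'] at this
    obtain ⟨c, hc, h⟩ := hf.exists_phase hg
      (fun Λ x => congrFun (congrFun (congrArg Subtype.val heq) Λ) x) hne
    refine ⟨c, hc, ?_⟩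
    rw [smul_smul]
    congr 1
    refine Subtype.ext (funext fun Λ => funext fun x => ?_)
    exact (h Λ x).trans (Algebra.smul_def c (f.1 Λ x))
  · rintro f ⟨-, F₁, F₂, hf⟩ hr
    obtain ⟨G, hG, hG'⟩ := hf.exists_differentiableOn
    obtain ⟨x₀⟩ : Nonempty X := inferInstance
    obtain ⟨r, hr'⟩ := exists_eq_of_real hG fun p hp => by
      rw [← hG' ⟨p, hp⟩ x₀, ← Gr.body_conj, hr]
    refine ⟨r, fun Λ x => ?_⟩
    rw [hf.eq_body_of_conj_eq hr, hG', hr' _ Λ.2]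
    rfl
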